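/- Let $n\ge 2$ be an integer and consider the radial Euler equations $$U_t+UU_r+\tfrac1\rho(p_SS_r+p_\rho\rho_r)=0,\qquad \rho_t+(U\rho)_r+\tfrac{n-1}{r}U\rho=0,\qquad S_t+US_r=0$$ for $r>0$, with a non-constant equation of state $p=p(\rho,S)$ of class $C^2$ on $R\times I$, where $R\subseteq(0,\infty)$ and $I\subseteq\mathbb R$ are non-empty open intervals. A scalar invariant (up to first order) on an open set $D$ of jets $(t,r,U,\rho,S,U_r,\rho_r,S_r)$ with $r>0$, $(\rho,S)\in R\times I$ is a $C^1$ function $J(t,r,U,\rho,S,U_r,\rho_r,S_r)$ on $D$ such that $D_tJ+U\,D_rJ=0$ holds on the solution space, that is, holds identically in all remaining jet variables, including $U_{rr},\rho_{rr},S_{rr}$, after all $t$-derivatives are eliminated by means of the Euler equations and their total $r$-derivatives. An invariant is called additional if it is not locally a $C^1$ function of $S$ and $r^{1-n}S_r/\rho$. (i) Suppose that $p_\rho$ does not vanish identically on any non-empty open subset of $R\times I$. Then a function on the set of all jets with $r>0$, $(\rho,S)\in R\times I$ is a scalar invariant if and only if it is a $C^1$ function of $$S,\qquad r^{1-n}S_r/\rho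 .$$ Likewise, a function on an arbitrary open set $D$ of such jets is a scalar invariant on $D$ if and only if it is, near each point of $D$, a $C^1$ function of these two quantities. (ii) The only special equation of state with additional invariants is the entropic one, $p=\kappa(S)$ with $\kappa$ non-constant: additional invariants exist over every non-empty open subset of $R\times I$ if and only if $p=\kappa(S)$ on $R\times I$ for some non-constant $\kappa$; and if $p$ is real-analytic, the existence of a single additional invariant on some open set of jets is already equivalent to $p=\kappa(S)$ on $R\times I$ with $\kappa$ non-constant. Let $p=\kappa(S)$ with $\kappa$ not constant on any non-empty open subset of $I$. Then $U^2+\tfrac2n r\kappa'(S)S_r/\rho$ is a scalar invariant on the set of all jets with $r>0$, $(\rho,S)\in R\times I$. Let $\sigma\in\{1,-1\}$ and let $D_\sigma$ be the set of such jets for which moreover $\sigma U>0$ and $U^2+\tfrac2n\big(1-(y/r)^n\big)r\kappa'(S)S_r/\rho>0$ for all $0\le y\le r$. Then a function on $D_\sigma$ is a scalar invariant if and only if it is a $C^1$ function of the four quantities $$S,\qquad \frac{r^{1-n}S_r}{\rho},\qquad U^2+\tfrac2n\,\frac{r\kappa'(S)S_r}{\rho},\qquad \sigma A-t,\qquad A=\int_0^r\frac{dy}{\sqrt{U^2+\tfrac2n\big(1-(y/r)^n\big)r\kappa'(S)S_r/\rho}},$$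 and a function on an arbitrary open set $D\subseteq D_\sigma$ is a scalar invariant on $D$ if and only if it is, near each point of $D$, a $C^1$ function of these four quantities. -/

import Mathlib

open Set Filter Topology

noncomputable section

namespace RadialEuler

/-- First-order radial jet space: points are `(t, r, U, ρ, S, U_r, ρ_r, S_r)`. -/
abbrev Jet : Type := Fin 8 → ℝ

namespace Jet

/-- time -/
def t (j : Jet) : ℝ := j 0
/-- radius -/
def r (j : Jet) : ℝ := j 1
/-- radial velocity -/
def U (j : Jet) : ℝ := j 2
/-- density -/
def ρ (j : Jet) : ℝ := j 3
/-- entropy -/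
def S (j : Jet) : ℝ := j 4
/-- radial derivative of the velocity -/
def Ur (j : Jet) : ℝ := j 5
/-- radial derivative of the density -/
def ρr (j : Jet) : ℝ := j 6
/-- radial derivative of the entropy -/
def Sr (j : Jet) : ℝ := j 7

end Jet

/-- The partial derivative `p_ρ` of an equation of state `p = p(ρ, S)`. -/
def dRho (p : ℝ → ℝ → ℝ) (ρ S : ℝ) : ℝ := deriv (fun x => p x S) ρ

/-- The partial derivative `p_S` of an equation of state `p = p(ρ, S)`. -/
def dS (p : ℝ → ℝ → ℝ) (ρ S : ℝ) : ℝ := deriv (fun s => p ρ s) S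

/-- `U_t` as given by the velocity equation `U_t + U U_r + (p_S S_r + p_ρ ρ_r)/ρ = 0`. -/
def Ut (p : ℝ → ℝ → ℝ) (j : Jet) : ℝ :=
  -(j.U * j.Ur + (dS p j.ρ j.S * j.Sr + dRho p j.ρ j.S * j.ρr) / j.ρ)

/-- `ρ_t` as given by the density equation `ρ_t + (U ρ)_r + ((n-1)/r) U ρ = 0`. -/
def ρt (n : ℕ) (j : Jet) : ℝ :=
  -((j.Ur * j.ρ + j.U * j.ρr) + ((n : ℝ) - 1) / j.r * j.U * j.ρ)

/-- `S_t` as given by the entropy equation `S_t + U S_r = 0`. -/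
def St (j : Jet) : ℝ := -(j.U * j.Sr)

/-- The total radial derivative `D_r F` of a function `F` on the first-order jet space; it
depends in addition on the second-order jet coordinates `U_rr`, `ρ_rr`, `S_rr`. -/
def totalDr (F : Jet → ℝ) (j : Jet) (Urr ρrr Srr : ℝ) : ℝ :=
  fderiv ℝ F j ![0, 1, j.Ur, j.ρr, j.Sr, Urr, ρrr, Srr]

/-- The total time derivative `D_t F` of a function `F` on the first-order jet space, restricted
to the solution space: `U_t`, `ρ_t`, `S_t` are eliminated by the radial Euler equations, and
`U_rt`, `ρ_rt`, `S_rt` by the total radial derivatives of these equations. -/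
def totalDt (p : ℝ → ℝ → ℝ) (n : ℕ) (F : Jet → ℝ) (j : Jet) (Urr ρrr Srr : ℝ) : ℝ :=
  fderiv ℝ F j ![1, 0, Ut p j, ρt n j, St j,
    totalDr (Ut p) j Urr ρrr Srr, totalDr (ρt n) j Urr ρrr Srr, totalDr St j Urr ρrr Srr]

/-- `J(t, r, U, ρ, S, U_r, ρ_r, S_r)`, of class `C¹` on `D`, is a scalar invariant on `D`:
`D_t J + U D_r J = 0` holds on the solution space, identically in the jet variables. -/
def IsInvariantOn (p : ℝ → ℝ → ℝ) (n : ℕ) (D : Set Jet) (J : Jet → ℝ) : Prop :=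
  ContDiffOn ℝ 1 J D ∧
    ∀ j ∈ D, ∀ Urr ρrr Srr : ℝ,
      totalDt p n J j Urr ρrr Srr + j.U * totalDr J j Urr ρrr Srr = 0

/-- The jets with `r > 0` whose thermodynamic state `(ρ, S)` lies in `W`. -/
def jetsOver (W : Set (ℝ × ℝ)) : Set Jet := {j | 0 < j.r ∧ (j.ρ, j.S) ∈ W}

/-- On `D`, `J` is a `C¹` function of the quantities `Φ`. -/
def IsFunctionOf {k : ℕ} (Φ : Jet → Fin k → ℝ) (J : Jet → ℝ) (D : Set Jet) : Prop :=
  ∃ f : (Fin k → ℝ) → ℝ, ContDiffOn ℝ 1 f (Φ '' D) ∧ ∀ j ∈ D, J j = f (Φ j)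

/-- Near every point of `D`, `J` is a `C¹` function of the quantities `Φ`. -/
def IsLocallyFunctionOf {k : ℕ} (Φ : Jet → Fin k → ℝ) (J : Jet → ℝ) (D : Set Jet) : Prop :=
  ∀ j ∈ D, ∃ f : (Fin k → ℝ) → ℝ, ContDiffAt ℝ 1 f (Φ j) ∧ ∀ᶠ j' in 𝓝 j, J j' = f (Φ j')

/-- The quantity `r^{1-n} S_r / ρ`. -/
def entropyGradient (n : ℕ) (j : Jet) : ℝ := j.r ^ (1 - (n : ℤ)) * j.Sr / j.ρ

/-- The pair `S`, `r^{1-n} S_r / ρ`. -/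
def basicInvariants (n : ℕ) (j : Jet) : Fin 2 → ℝ := ![j.S, entropyGradient n j]

/-- Over the states `W`, there is a first-order scalar invariant, defined on some open set of
jets, that is not (locally) a function of `S` and `r^{1-n} S_r / ρ`. -/
def HasAdditionalInvariant (p : ℝ → ℝ → ℝ) (n : ℕ) (W : Set (ℝ × ℝ)) : Prop :=
  ∃ (D : Set Jet) (J : Jet → ℝ), IsOpen D ∧ D ⊆ jetsOver W ∧ IsInvariantOn p n D J ∧
    ¬ IsLocallyFunctionOf (basicInvariants n) J D

/-- The equation of state is entropic on `R × I`: `p = κ(S)` with `κ` non-constant. -/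
def IsEntropic (p : ℝ → ℝ → ℝ) (R I : Set ℝ) : Prop :=
  ∃ κ : ℝ → ℝ, (∃ s ∈ I, ∃ s' ∈ I, κ s ≠ κ s') ∧ ∀ ρ ∈ R, ∀ S ∈ I, p ρ S = κ S

/-- The quantity `U² + (2/n) r κ'(S) S_r / ρ`. -/
def energyInvariant (κ : ℝ → ℝ) (n : ℕ) (j : Jet) : ℝ :=
  j.U ^ 2 + 2 / (n : ℝ) * j.r * deriv κ j.S * j.Sr / j.ρ

/-- The radicand `U² + (2/n) (1 - (y/r)^n) r κ'(S) S_r / ρ`. -/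
def radicand (κ : ℝ → ℝ) (n : ℕ) (j : Jet) (y : ℝ) : ℝ :=
  j.U ^ 2 + 2 / (n : ℝ) * (1 - (y / j.r) ^ n) * j.r * deriv κ j.S * j.Sr / j.ρ

/-- The integral `A = ∫_0^r dy / √(U² + (2/n) (1 - (y/r)^n) r κ'(S) S_r / ρ)`. -/
def travelTime (κ : ℝ → ℝ) (n : ℕ) (j : Jet) : ℝ :=
  ∫ y in (0 : ℝ)..j.r, 1 / Real.sqrt (radicand κ n j y)

/-- The jets over `W` at which the velocity has the sign `σ` and the integrand of `A` is real
and finite on the whole range of integration. -/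
def travelRegion (κ : ℝ → ℝ) (n : ℕ) (W : Set (ℝ × ℝ)) (σ : ℝ) : Set Jet :=
  {j | j ∈ jetsOver W ∧ 0 < σ * j.U ∧ ∀ y ∈ Icc 0 j.r, 0 < radicand κ n j y}

/-- The quantities `S`, `r^{1-n} S_r / ρ`, `U² + (2/n) r κ'(S) S_r / ρ`, `σ A - t`. -/
def entropicInvariants (κ : ℝ → ℝ) (n : ℕ) (σ : ℝ) (j : Jet) : Fin 4 → ℝ :=
  ![j.S, entropyGradient n j, energyInvariant κ n j, σ * travelTime κ n j - j.t]

end RadialEuler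

end

noncomputable section

namespace RadialEuler

/-! On the solution space `D_t + U D_r` acts on first-order functions as a directional derivative,
along `eulerDirection`, which is affine in the free coordinates `U_rr`, `ρ_rr`, `S_rr`. The
coefficient of `U_rr` gives `J_{ρ_r} = 0`; those of `ρ_rr` and `S_rr` give `p_ρ J_{U_r} = p_S
J_{U_r} = 0`, hence `J_{U_r} = 0` as soon as `p_ρ` or `p_S` vanishes on no open set. What remains is
affine in `U_r` and `ρ_r`, on which `J` no longer depends, and splits into `ρ J_ρ + S_r J_{S_r} =
0`, `p_ρ J_U = 0` and a transport equation (`IsInvariantOn.determining_equations`).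

If `p_ρ` vanishes on no open set, then `J_U = 0`, the transport equation splits in powers of `U`,
and `J` is annihilated by every direction tangent to the fibres of `S` and `E = r^{1-n} S_r / ρ`. If
`p = κ(S)`, the equation `p_ρ J_U = 0` is void and the transport equation survives. Along its
characteristics `S`, `E` and `Q = U² + c rⁿ` with `c = (2/n) κ'(S) E` are constant, so `dr/dt = U =
σ √(Q - c rⁿ)` integrates to the fourth invariant `σ A - t`.

In both cases the invariants are thus the `C¹` functions with zero derivative along the fibres of an
explicit chart. Small balls in a fibre give the local factorization through the chart's quantities;
convexity of the whole fibres gives the global one (`IsFibredChart.isInvariantOn_iff`).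

For the classification, `p_ρ ≠ 0` at one state persists on an open set, over which no additional
invariant exists; if `p_ρ = 0` everywhere then `p = κ(S)`, and `Q` is additional since it depends on
`U`. For analytic `p`, vanishing of `p_ρ` on one open set spreads by the identity theorem. -/

/-- A fibred chart: `j ↦ (Φ j, π j)` identifies `D` with `Ω`, with inverse `Ψ`, in such a way that
the fibres of `Φ` become convex. -/
structure IsFibredChart {k : ℕ} {Y : Type*} [NormedAddCommGroup Y] [NormedSpace ℝ Y]
    (Φ : Jet → Fin k → ℝ) (π : Jet → Y) (Ψ : (Fin k → ℝ) × Y → Jet) (D : Set Jet)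
    (Ω : Set ((Fin k → ℝ) × Y)) : Prop where
  isOpen_source : IsOpen D
  isOpen_target : IsOpen Ω
  mem_target : ∀ j ∈ D, (Φ j, π j) ∈ Ω
  mem_source : ∀ z ∈ Ω, Ψ z ∈ D
  left_inv : ∀ j ∈ D, Ψ (Φ j, π j) = j
  right_inv : ∀ z ∈ Ω, Φ (Ψ z) = z.1
  contDiffOn_quantities : ContDiffOn ℝ 1 Φ D
  continuousOn_fibre : ContinuousOn π D
  contDiffOn_symm : ContDiffOn ℝ 1 Ψ Ω
  convex_fibre : ∀ x, Convex ℝ {y | (x, y) ∈ Ω}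

/-- `J` has vanishing derivative along the fibres of a fibred chart. -/
def IsVerticallyConstantOn {k : ℕ} {Y : Type*} [NormedAddCommGroup Y] [NormedSpace ℝ Y]
    (Ψ : (Fin k → ℝ) × Y → Jet) (Ω : Set ((Fin k → ℝ) × Y)) (D : Set Jet) (J : Jet → ℝ) : Prop :=
  ∀ z ∈ Ω, Ψ z ∈ D → ∀ v : Y, fderiv ℝ J (Ψ z) (fderiv ℝ Ψ z (0, v)) = 0

/-! ### Functions constant along the fibres of a chart -/

namespace IsFibredChart

variable {k : ℕ} {Y : Type*} [NormedAddCommGroup Y] [NormedSpace ℝ Y]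
  {Φ : Jet → Fin k → ℝ} {π : Jet → Y} {Ψ : (Fin k → ℝ) × Y → Jet} {D₀ : Set Jet}
  {Ω : Set ((Fin k → ℝ) × Y)} {D : Set Jet} {J : Jet → ℝ}

theorem differentiableAt_symm (h : IsFibredChart Φ π Ψ D₀ Ω) {z} (hz : z ∈ Ω) :
    DifferentiableAt ℝ Ψ z :=
  (h.contDiffOn_symm.contDiffAt (h.isOpen_target.mem_nhds hz)).differentiableAt one_ne_zero

theorem contDiffAt_quantities (h : IsFibredChart Φ π Ψ D₀ Ω) {j} (hj : j ∈ D₀) :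
    ContDiffAt ℝ 1 Φ j :=
  h.contDiffOn_quantities.contDiffAt (h.isOpen_source.mem_nhds hj)

theorem hasFDerivAt_fibre (h : IsFibredChart Φ π Ψ D₀ Ω) {x : Fin k → ℝ} {y : Y}
    (hz : (x, y) ∈ Ω) (hJ : DifferentiableAt ℝ J (Ψ (x, y))) :
    HasFDerivAt (fun y => J (Ψ (x, y)))
      ((fderiv ℝ J (Ψ (x, y))).comp ((fderiv ℝ Ψ (x, y)).comp
        (ContinuousLinearMap.inr ℝ (Fin k → ℝ) Y))) y := by
  have h1 : HasFDerivAt (fun y : Y => (x, y)) (ContinuousLinearMap.inr ℝ (Fin k → ℝ) Y) y :=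
    hasFDerivAt_prodMk_right x y
  have h2 := (h.differentiableAt_symm hz).hasFDerivAt.comp y h1
  exact hJ.hasFDerivAt.comp y h2

/-- Mean value inequality with bound `0` on a convex piece `C` of one fibre. `C` is a small ball
when `D` is arbitrary, and the whole fibre when `D` is the chart domain. -/
theorem eq_of_fibre (h : IsFibredChart Φ π Ψ D₀ Ω) (hD : IsOpen D) (hJ : ContDiffOn ℝ 1 J D)
    (hv : IsVerticallyConstantOn Ψ Ω D J) {C : Set Y} (hC : Convex ℝ C) {x : Fin k → ℝ}
    (hxC : ∀ y ∈ C, (x, y) ∈ Ω ∧ Ψ (x, y) ∈ D) {y y' : Y} (hy : y ∈ C) (hy' : y' ∈ C) :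
    J (Ψ (x, y)) = J (Ψ (x, y')) := by
  have key : ∀ w ∈ C, HasFDerivWithinAt (fun y => J (Ψ (x, y))) (0 : Y →L[ℝ] ℝ) C w := by
    intro w hw
    obtain ⟨h1, h2⟩ := hxC w hw
    have h3 := h.hasFDerivAt_fibre h1
      ((hJ.contDiffAt (hD.mem_nhds h2)).differentiableAt one_ne_zero)
    refine (h3.congr_fderiv ?_).hasFDerivWithinAt
    ext v
    exact hv _ h1 h2 v
  have := hC.norm_image_sub_le_of_norm_hasFDerivWithin_le (C := 0) key (by simp) hy' hy
  simpa [sub_eq_zero] using this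

theorem isLocallyFunctionOf (h : IsFibredChart Φ π Ψ D₀ Ω) (hDD : D ⊆ D₀) (hD : IsOpen D)
    (hJ : ContDiffOn ℝ 1 J D) (hv : IsVerticallyConstantOn Ψ Ω D J) :
    IsLocallyFunctionOf Φ J D := by
  intro j hj
  have hz := h.mem_target j (hDD hj)
  have hc : ContinuousAt Ψ (Φ j, π j) := (h.differentiableAt_symm hz).continuousAt
  have hN : Ω ∩ Ψ ⁻¹' D ∈ 𝓝 (Φ j, π j) := by
    refine inter_mem (h.isOpen_target.mem_nhds hz) (hc.preimage_mem_nhds (hD.mem_nhds ?_))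
    rwa [h.left_inv j (hDD hj)]
  obtain ⟨ε, hε, hball⟩ := Metric.mem_nhds_iff.1 hN
  -- A product neighbourhood meets every nearby fibre in the same ball around `π j`, so each nearby
  -- jet can be joined inside its fibre to the slice `y = π j`.
  rw [← ball_prod_same] at hball
  refine ⟨fun x => J (Ψ (x, π j)), ?_, ?_⟩
  · have h1 : ContDiffAt ℝ 1 (fun x : Fin k → ℝ => (x, π j)) (Φ j) := by fun_prop
    have h2 := (h.contDiffOn_symm.contDiffAt (h.isOpen_target.mem_nhds hz)).comp (Φ j) h1
    refine ContDiffAt.comp (Φ j) ?_ h2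
    rw [h.left_inv j (hDD hj)]
    exact hJ.contDiffAt (hD.mem_nhds hj)
  · have c1 : ContinuousAt Φ j := (h.contDiffAt_quantities (hDD hj)).continuousAt
    have c2 : ContinuousAt π j :=
      h.continuousOn_fibre.continuousAt (h.isOpen_source.mem_nhds (hDD hj))
    filter_upwards [c1 (Metric.ball_mem_nhds _ hε), c2 (Metric.ball_mem_nhds _ hε),
      hD.mem_nhds hj] with j' h1 h2 h3
    have := h.eq_of_fibre hD hJ hv (convex_ball (π j) ε) (x := Φ j')
      (fun y hy => hball ⟨h1, hy⟩) h2 (Metric.mem_ball_self hε)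
    rw [h.left_inv j' (hDD h3)] at this
    exact this

theorem isFunctionOf (h : IsFibredChart Φ π Ψ D₀ Ω)
    (hJ : ContDiffOn ℝ 1 J D₀) (hv : IsVerticallyConstantOn Ψ Ω D₀ J) :
    IsFunctionOf Φ J D₀ := by
  classical
  -- The chosen fibre point is irrelevant because the whole fibre is convex; off the projection of
  -- `Ω` the value `0` is arbitrary. Smoothness is local and is inherited below from the local
  -- factorization `g`.
  let f : (Fin k → ℝ) → ℝ := fun x => if hx : ∃ y, (x, y) ∈ Ω then J (Ψ (x, hx.choose)) else 0
  have hf : ∀ z ∈ Ω, f z.1 = J (Ψ z) := by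
    rintro ⟨x, y⟩ hz
    have hx : ∃ y, (x, y) ∈ Ω := ⟨y, hz⟩
    simp only [f, dif_pos hx]
    exact h.eq_of_fibre h.isOpen_source hJ hv (h.convex_fibre x) (x := x)
      (fun w hw => ⟨hw, h.mem_source _ hw⟩) hx.choose_spec hz
  have hfj : ∀ j ∈ D₀, J j = f (Φ j) := fun j hj => by
    have := hf _ (h.mem_target j hj)
    rw [h.left_inv j hj] at this
    exact this.symm
  refine ⟨f, ?_, hfj⟩
  rintro _ ⟨j, hj, rfl⟩
  obtain ⟨g, hg, hgJ⟩ := h.isLocallyFunctionOf subset_rfl h.isOpen_source hJ hv j hj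
  refine ContDiffAt.contDiffWithinAt (hg.congr_of_eventuallyEq ?_)
  have hz := h.mem_target j hj
  have h1 : ContinuousAt (fun x : Fin k → ℝ => (x, π j)) (Φ j) := by fun_prop
  have h2 : ContinuousAt (fun x : Fin k → ℝ => Ψ (x, π j)) (Φ j) :=
    ContinuousAt.comp (f := fun x : Fin k → ℝ => (x, π j))
      (h.differentiableAt_symm hz).continuousAt h1
  have h3 : ∀ᶠ j' in 𝓝 (Ψ (Φ j, π j)), J j' = g (Φ j') := by rwa [h.left_inv j hj]
  filter_upwards [h1 (h.isOpen_target.mem_nhds hz), h2.eventually h3] with x hx hx'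
  rw [hf (x, π j) hx, hx', h.right_inv _ hx]

theorem isOpen_image (h : IsFibredChart Φ π Ψ D₀ Ω) : IsOpen (Φ '' D₀) := by
  have : Φ '' D₀ = Prod.fst '' Ω := by
    ext x
    constructor
    · rintro ⟨j, hj, rfl⟩
      exact ⟨_, h.mem_target j hj, rfl⟩
    · rintro ⟨z, hz, rfl⟩
      exact ⟨_, h.mem_source z hz, h.right_inv z hz⟩
  rw [this]
  exact isOpenMap_fst _ h.isOpen_target

theorem isLocallyFunctionOf_of_isFunctionOf (h : IsFibredChart Φ π Ψ D₀ Ω)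
    (hJ : IsFunctionOf Φ J D₀) : IsLocallyFunctionOf Φ J D₀ := by
  obtain ⟨f, hf, hfJ⟩ := hJ
  intro j hj
  refine ⟨f, hf.contDiffAt (h.isOpen_image.mem_nhds ⟨j, hj, rfl⟩), ?_⟩
  filter_upwards [h.isOpen_source.mem_nhds hj] with j' hj' using hfJ j' hj'

theorem contDiffOn_of_isLocallyFunctionOf (h : IsFibredChart Φ π Ψ D₀ Ω) (hDD : D ⊆ D₀)
    (hJ : IsLocallyFunctionOf Φ J D) : ContDiffOn ℝ 1 J D := by
  intro j hj
  obtain ⟨f, hf, hfJ⟩ := hJ j hj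
  have h1 : ContDiffAt ℝ 1 (fun j => f (Φ j)) j :=
    ContDiffAt.comp j hf (h.contDiffAt_quantities (hDD hj))
  exact (h1.congr_of_eventuallyEq hfJ).contDiffWithinAt

theorem isVerticallyConstantOn (h : IsFibredChart Φ π Ψ D₀ Ω) (hDD : D ⊆ D₀) (hD : IsOpen D)
    (hJ : IsLocallyFunctionOf Φ J D) : IsVerticallyConstantOn Ψ Ω D J := by
  rintro ⟨x, y⟩ hz hzD v
  have h1 := h.hasFDerivAt_fibre hz
    (((h.contDiffOn_of_isLocallyFunctionOf hDD hJ).contDiffAt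
      (hD.mem_nhds hzD)).differentiableAt one_ne_zero)
  obtain ⟨f, -, hfJ⟩ := hJ _ hzD
  have h2 : ContinuousAt (fun y : Y => (x, y)) y := by fun_prop
  have h3 : ContinuousAt (fun y : Y => Ψ (x, y)) y :=
    ContinuousAt.comp (f := fun y : Y => (x, y)) (h.differentiableAt_symm hz).continuousAt h2
  have h4 : (fun y => J (Ψ (x, y))) =ᶠ[𝓝 y] fun _ => f x := by
    filter_upwards [h2 (h.isOpen_target.mem_nhds hz), h3.eventually hfJ] with w hw hw'
    rw [hw', h.right_inv _ hw]
  have h5 := h1.unique ((hasFDerivAt_const (f x) y).congr_of_eventuallyEq h4)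
  exact DFunLike.congr_fun h5 v

/-- If, among the functions of class `C¹`, the invariants are those with vanishing derivative along
the fibres of a chart, then they are the functions of the quantities `Φ`. -/
theorem isInvariantOn_iff (h : IsFibredChart Φ π Ψ D₀ Ω) {p : ℝ → ℝ → ℝ} {n : ℕ}
    (hv : ∀ D ⊆ D₀, IsOpen D → ∀ J, ContDiffOn ℝ 1 J D →
      (IsInvariantOn p n D J ↔ IsVerticallyConstantOn Ψ Ω D J)) :
    (∀ J, IsInvariantOn p n D₀ J ↔ IsFunctionOf Φ J D₀) ∧
    (∀ D ⊆ D₀, IsOpen D → ∀ J, IsInvariantOn p n D J ↔ IsLocallyFunctionOf Φ J D) := by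
  have key : ∀ D ⊆ D₀, IsOpen D → ∀ J, IsLocallyFunctionOf Φ J D → IsInvariantOn p n D J :=
    fun D hDD hD J hJ => (hv D hDD hD J (h.contDiffOn_of_isLocallyFunctionOf hDD hJ)).2
      (h.isVerticallyConstantOn hDD hD hJ)
  refine ⟨fun J => ⟨fun hJ => ?_, fun hJ => ?_⟩, fun D hDD hD J => ⟨fun hJ => ?_, key D hDD hD J⟩⟩
  · exact h.isFunctionOf hJ.1 ((hv D₀ subset_rfl h.isOpen_source J hJ.1).1 hJ)
  · exact key D₀ subset_rfl h.isOpen_source J (h.isLocallyFunctionOf_of_isFunctionOf hJ)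
  · exact h.isLocallyFunctionOf hDD hD hJ.1 ((hv D hDD hD J hJ.1).1 hJ)

end IsFibredChart

/-! ### Partial derivatives on the jet space -/

theorem fderiv_eq_of_hasDerivAt_line {E F : Type*} [NormedAddCommGroup E] [NormedSpace ℝ E]
    [NormedAddCommGroup F] [NormedSpace ℝ F] {f : E → F} {x v : E} {w : F}
    (hf : DifferentiableAt ℝ f x) (h : HasDerivAt (fun s : ℝ => f (x + s • v)) w 0) :
    fderiv ℝ f x v = w :=
  (hf.hasFDerivAt.hasLineDerivAt v).unique h

theorem fderiv_eq_of_affine {E : Type*} [NormedAddCommGroup E] [NormedSpace ℝ E] {f : E → ℝ}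
    {x v : E} {c : ℝ} (hf : DifferentiableAt ℝ f x) (h : ∀ s : ℝ, f (x + s • v) = f x + s * c) :
    fderiv ℝ f x v = c := by
  refine fderiv_eq_of_hasDerivAt_line hf ?_
  simp only [h]
  simpa using ((hasDerivAt_id (0 : ℝ)).mul_const c).const_add (f x)

/-- The partial derivative of `J` with respect to the `i`-th jet coordinate. -/
def jetPartial (J : Jet → ℝ) (i : Fin 8) (j : Jet) : ℝ := fderiv ℝ J j (Pi.single i 1)

theorem fderiv_jet_apply (J : Jet → ℝ) (j w : Jet) :
    fderiv ℝ J j w = ∑ i, w i * jetPartial J i j := by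
  conv_lhs => rw [pi_eq_sum_univ' w]
  rw [map_sum]
  refine Finset.sum_congr rfl fun i _ => ?_
  rw [map_smul, smul_eq_mul, jetPartial]

theorem continuousOn_jetPartial {J : Jet → ℝ} {D : Set Jet} (hD : IsOpen D)
    (hJ : ContDiffOn ℝ 1 J D) (i : Fin 8) : ContinuousOn (jetPartial J i) D :=
  (hJ.continuousOn_fderiv_of_isOpen hD le_rfl).clm_apply continuousOn_const

theorem differentiableAt_of_contDiffOn {J : Jet → ℝ} {D : Set Jet} (hD : IsOpen D)
    (hJ : ContDiffOn ℝ 1 J D) {j : Jet} (hj : j ∈ D) : DifferentiableAt ℝ J j :=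
  (hJ.contDiffAt (hD.mem_nhds hj)).differentiableAt one_ne_zero

/-- If `J` does not depend on the direction `e`, neither does its derivative. -/
theorem eventually_fderiv_translate {J : Jet → ℝ} {D : Set Jet} (hD : IsOpen D)
    (hJ : ContDiffOn ℝ 1 J D) {e : Jet} (he : ∀ j ∈ D, fderiv ℝ J j e = 0) {j : Jet}
    (hj : j ∈ D) :
    ∀ᶠ s : ℝ in 𝓝 0, j + s • e ∈ D ∧ fderiv ℝ J (j + s • e) = fderiv ℝ J j := by
  obtain ⟨ε, hε, hball⟩ := Metric.isOpen_iff.1 hD j hj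
  have hc : Continuous fun s : ℝ => j + s • e := by fun_prop
  have h0 : ∀ᶠ s : ℝ in 𝓝 0, j + s • e ∈ Metric.ball j ε :=
    hc.continuousAt.eventually_mem
      (by rw [zero_smul, add_zero]; exact Metric.ball_mem_nhds j hε)
  filter_upwards [h0] with s hs
  refine ⟨hball hs, ?_⟩
  -- As `J` is only `C¹`, mixed second derivatives are not available. Instead `J` is compared with
  -- its translate: they agree near `j`, being constant along segments inside a ball.
  have hev : (fun x => J (x + s • e)) =ᶠ[𝓝 j] J := by
    have hc' : Continuous fun x : Jet => x + s • e := by fun_prop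
    filter_upwards [Metric.ball_mem_nhds j hε,
      hc'.continuousAt.preimage_mem_nhds (Metric.isOpen_ball.mem_nhds hs)] with x hx hx'
    have key : ∀ τ ∈ Icc (0 : ℝ) 1,
        HasDerivWithinAt (fun τ : ℝ => J (x + τ • (s • e))) 0 (Icc 0 1) τ := by
      intro τ hτ
      have hm : x + τ • (s • e) ∈ D :=
        hball ((convex_ball j ε).add_smul_mem hx hx' hτ)
      have h1 : HasDerivAt (fun τ : ℝ => x + τ • (s • e)) (s • e) τ := by
        simpa using ((hasDerivAt_id τ).smul_const (s • e)).const_add x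
      have h2 := (differentiableAt_of_contDiffOn hD hJ hm).hasFDerivAt.comp_hasDerivAt τ h1
      rw [map_smul, he _ hm, smul_zero] at h2
      exact h2.hasDerivWithinAt
    have := (convex_Icc (0 : ℝ) 1).norm_image_sub_le_of_norm_hasDerivWithin_le (C := 0) key
      (by simp) (left_mem_Icc.2 zero_le_one) (right_mem_Icc.2 zero_le_one)
    simpa [sub_eq_zero] using this
  rw [← hev.fderiv_eq, fderiv_comp_add_right]

/-- A continuous factor of an identically vanishing product vanishes if the other factor, a
function of the state, vanishes on no open set of states. -/
theorem eq_zero_of_mul_state_eq_zero {g : Jet → ℝ} {D : Set Jet} {W : Set (ℝ × ℝ)}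
    {q : ℝ → ℝ → ℝ} (hD : IsOpen D) (hW : IsOpen W) (hDW : D ⊆ jetsOver W)
    (hg : ContinuousOn g D) (hq : ∀ V ⊆ W, IsOpen V → V.Nonempty → ∃ z ∈ V, q z.1 z.2 ≠ 0)
    (h : ∀ j ∈ D, g j * q j.ρ j.S = 0) : ∀ j ∈ D, g j = 0 := by
  intro j hj
  by_contra hne
  have hN : IsOpen (D ∩ g ⁻¹' {0}ᶜ) := hg.isOpen_inter_preimage hD isOpen_compl_singleton
  -- Only the state is varied, the other six coordinates being those of `j`: the states at which `g
  -- ≠ 0` then form a nonempty open set, where `q` cannot vanish identically.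
  let m : ℝ × ℝ → Jet := fun z => Function.update (Function.update j 3 z.1) 4 z.2
  have hm : Continuous m :=
    ((continuous_const (y := j)).update (3 : Fin 8) continuous_fst).update 4 continuous_snd
  have hm3 : ∀ z, (m z).ρ = z.1 := fun z => by simp [m, Jet.ρ]
  have hm4 : ∀ z, (m z).S = z.2 := fun z => by simp [m, Jet.S]
  have hmj : m (j.ρ, j.S) = j := by simp [m, Jet.ρ, Jet.S]
  obtain ⟨z, ⟨-, hzD, hzg⟩, hzq⟩ := hq (W ∩ m ⁻¹' (D ∩ g ⁻¹' {0}ᶜ)) inter_subset_left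
    (hW.inter (hN.preimage hm)) ⟨(j.ρ, j.S), (hDW hj).2, by rw [mem_preimage, hmj]; exact ⟨hj, hne⟩⟩
  have := h _ hzD
  rw [hm3, hm4] at this
  exact (mul_eq_zero.1 this).elim hzg hzq

theorem isOpen_jetsOver {W : Set (ℝ × ℝ)} (hW : IsOpen W) : IsOpen (jetsOver W) := by
  have h1 : Continuous fun j : Jet => j.r := continuous_apply 1
  have h2 : Continuous fun j : Jet => (j.ρ, j.S) :=
    (continuous_apply (3 : Fin 8)).prodMk (continuous_apply (4 : Fin 8))
  exact (isOpen_lt continuous_const h1).inter (hW.preimage h2)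

/-! ### The equation of state -/

theorem hasFDerivAt_state {p : ℝ → ℝ → ℝ} {W : Set (ℝ × ℝ)} (hW : IsOpen W)
    (hp : ContDiffOn ℝ 2 (Function.uncurry p) W) {z : ℝ × ℝ} (hz : z ∈ W) :
    HasFDerivAt (Function.uncurry p) (fderiv ℝ (Function.uncurry p) z) z :=
  ((hp.contDiffAt (hW.mem_nhds hz)).differentiableAt two_ne_zero).hasFDerivAt

theorem dRho_eq_fderiv {p : ℝ → ℝ → ℝ} {W : Set (ℝ × ℝ)} (hW : IsOpen W)
    (hp : ContDiffOn ℝ 2 (Function.uncurry p) W) {z : ℝ × ℝ} (hz : z ∈ W) :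
    dRho p z.1 z.2 = fderiv ℝ (Function.uncurry p) z (1, 0) := by
  have h1 : HasDerivAt (fun x : ℝ => (x, z.2)) ((1 : ℝ), (0 : ℝ)) z.1 :=
    (hasDerivAt_id z.1).prodMk (hasDerivAt_const _ _)
  exact ((hasFDerivAt_state hW hp hz).comp_hasDerivAt z.1 h1).deriv

theorem dS_eq_fderiv {p : ℝ → ℝ → ℝ} {W : Set (ℝ × ℝ)} (hW : IsOpen W)
    (hp : ContDiffOn ℝ 2 (Function.uncurry p) W) {z : ℝ × ℝ} (hz : z ∈ W) :
    dS p z.1 z.2 = fderiv ℝ (Function.uncurry p) z (0, 1) := by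
  have h1 : HasDerivAt (fun x : ℝ => (z.1, x)) ((0 : ℝ), (1 : ℝ)) z.2 :=
    (hasDerivAt_const _ _).prodMk (hasDerivAt_id z.2)
  exact ((hasFDerivAt_state hW hp hz).comp_hasDerivAt z.2 h1).deriv

theorem contDiffOn_dRho {p : ℝ → ℝ → ℝ} {W : Set (ℝ × ℝ)} (hW : IsOpen W)
    (hp : ContDiffOn ℝ 2 (Function.uncurry p) W) :
    ContDiffOn ℝ 1 (fun z : ℝ × ℝ => dRho p z.1 z.2) W :=
  ((hp.fderiv_of_isOpen hW (m := 1) (by norm_num)).clm_apply contDiffOn_const).congr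
    fun _ hz => dRho_eq_fderiv hW hp hz

theorem contDiffOn_dS {p : ℝ → ℝ → ℝ} {W : Set (ℝ × ℝ)} (hW : IsOpen W)
    (hp : ContDiffOn ℝ 2 (Function.uncurry p) W) :
    ContDiffOn ℝ 1 (fun z : ℝ × ℝ => dS p z.1 z.2) W :=
  ((hp.fderiv_of_isOpen hW (m := 1) (by norm_num)).clm_apply contDiffOn_const).congr
    fun _ hz => dS_eq_fderiv hW hp hz

/-! ### The derivation `D_t + U D_r` on the solution space -/

/-- Only the dependence on the second-order coordinates matters, and it is governed by how `F`
depends on `(U_r, ρ_r, S_r)`. The part `totalDr F j 0 0 0` may stay unevaluated, so second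
derivatives of `p` never have to be computed. -/
theorem totalDr_eq_add {F : Jet → ℝ} {j : Jet} (hF : DifferentiableAt ℝ F j) {α β γ : ℝ}
    (h : ∀ a b c : ℝ, F (j + ![0, 0, 0, 0, 0, a, b, c]) = F j + (a * α + b * β + c * γ))
    (a b c : ℝ) : totalDr F j a b c = totalDr F j 0 0 0 + (a * α + b * β + c * γ) := by
  have h1 : (![0, 1, j.Ur, j.ρr, j.Sr, a, b, c] : Jet)
      = ![0, 1, j.Ur, j.ρr, j.Sr, 0, 0, 0] + ![0, 0, 0, 0, 0, a, b, c] := by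
    ext i; fin_cases i <;> simp
  rw [totalDr, h1, map_add, totalDr]
  congr 1
  refine fderiv_eq_of_affine hF fun s => ?_
  have h2 : s • (![0, 0, 0, 0, 0, a, b, c] : Jet) = ![0, 0, 0, 0, 0, s * a, s * b, s * c] := by
    ext i; fin_cases i <;> simp
  rw [h2, h]
  ring

/-- The direction of the derivation `D_t + U D_r` in the first-order jet space. -/
def eulerDirection (p : ℝ → ℝ → ℝ) (n : ℕ) (j : Jet) (Urr ρrr Srr : ℝ) : Jet :=
  ![1, j.U, -((dS p j.ρ j.S * j.Sr + dRho p j.ρ j.S * j.ρr) / j.ρ),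
    -(j.Ur * j.ρ + ((n : ℝ) - 1) / j.r * j.U * j.ρ), 0,
    totalDr (Ut p) j 0 0 0 - (dS p j.ρ j.S * Srr + dRho p j.ρ j.S * ρrr) / j.ρ,
    totalDr (ρt n) j 0 0 0 - j.ρ * Urr, -(j.Ur * j.Sr)]

section Euler

variable {p : ℝ → ℝ → ℝ} {n : ℕ} {W : Set (ℝ × ℝ)} {D : Set Jet} {J : Jet → ℝ}

theorem differentiableAt_Ut (hW : IsOpen W) (hp : ContDiffOn ℝ 2 (Function.uncurry p) W) {j : Jet}
    (hj : (j.ρ, j.S) ∈ W) (hρ : j.ρ ≠ 0) : DifferentiableAt ℝ (Ut p) j := by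
  have hm : DifferentiableAt ℝ (fun j : Jet => (j.ρ, j.S)) j := by
    unfold Jet.ρ Jet.S; fun_prop
  have h1 : DifferentiableAt ℝ (fun j : Jet => dRho p j.ρ j.S) j :=
    DifferentiableAt.comp (f := fun j : Jet => (j.ρ, j.S)) (g := fun z : ℝ × ℝ => dRho p z.1 z.2) j
      (((contDiffOn_dRho hW hp).contDiffAt (hW.mem_nhds hj)).differentiableAt one_ne_zero) hm
  have h2 : DifferentiableAt ℝ (fun j : Jet => dS p j.ρ j.S) j :=
    DifferentiableAt.comp (f := fun j : Jet => (j.ρ, j.S)) (g := fun z : ℝ × ℝ => dS p z.1 z.2) j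
      (((contDiffOn_dS hW hp).contDiffAt (hW.mem_nhds hj)).differentiableAt one_ne_zero) hm
  unfold Ut
  unfold Jet.ρ Jet.S at *
  unfold Jet.U Jet.Ur Jet.Sr Jet.ρr
  fun_prop (disch := assumption)

theorem totalDr_Ut (hW : IsOpen W) (hp : ContDiffOn ℝ 2 (Function.uncurry p) W) {j : Jet}
    (hj : (j.ρ, j.S) ∈ W) (hρ : j.ρ ≠ 0) (a b c : ℝ) :
    totalDr (Ut p) j a b c = totalDr (Ut p) j 0 0 0 +
      (a * -j.U + b * -(dRho p j.ρ j.S / j.ρ) + c * -(dS p j.ρ j.S / j.ρ)) := by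
  refine totalDr_eq_add (differentiableAt_Ut hW hp hj hρ) (fun a b c => ?_) a b c
  simp [Ut, Jet.U, Jet.Ur, Jet.ρ, Jet.S, Jet.Sr, Jet.ρr]
  ring

theorem totalDr_ρt {j : Jet} (hr : j.r ≠ 0) (a b c : ℝ) :
    totalDr (ρt n) j a b c = totalDr (ρt n) j 0 0 0 + (a * -j.ρ + b * -j.U + c * 0) := by
  have hd : DifferentiableAt ℝ (ρt n) j := by
    unfold ρt
    unfold Jet.r at *
    unfold Jet.ρ Jet.U Jet.Ur Jet.ρr
    fun_prop (disch := assumption)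
  refine totalDr_eq_add hd (fun a b c => ?_) a b c
  simp [ρt, Jet.U, Jet.Ur, Jet.ρ, Jet.r, Jet.ρr]
  ring

theorem totalDr_St (j : Jet) (a b c : ℝ) :
    totalDr St j a b c = -(j.Ur * j.Sr) - j.U * c := by
  have hd : DifferentiableAt ℝ St j := by
    unfold St Jet.U Jet.Sr
    fun_prop
  have h1 := totalDr_eq_add hd (α := 0) (β := 0) (γ := -j.U) (fun a b c => by
    simp [St, Jet.U, Jet.Sr]; ring) a b c
  have h2 : totalDr St j 0 0 0 = -(j.Ur * j.Sr) := by
    refine fderiv_eq_of_affine hd fun s => ?_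
    simp [St, Jet.U, Jet.Sr, Jet.Ur]; ring
  rw [h1, h2]
  ring

/-- The convective terms cancel: `-U U_rr`, `-U ρ_rr` and `-U S_rr` from the differentiated
equations are compensated by `U D_r`, as is `-U S_r` in the entropy component. -/
theorem totalDt_add_mul_totalDr (hW : IsOpen W) (hp : ContDiffOn ℝ 2 (Function.uncurry p) W)
    {j : Jet} (hj : j ∈ jetsOver W) (hρ : j.ρ ≠ 0) (Urr ρrr Srr : ℝ) :
    totalDt p n J j Urr ρrr Srr + j.U * totalDr J j Urr ρrr Srr =
      fderiv ℝ J j (eulerDirection p n j Urr ρrr Srr) := by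
  rw [totalDt, totalDr_Ut hW hp hj.2 hρ, totalDr_ρt hj.1.ne', totalDr_St,
    show totalDr J j Urr ρrr Srr = fderiv ℝ J j ![0, 1, j.Ur, j.ρr, j.Sr, Urr, ρrr, Srr] from rfl,
    ← smul_eq_mul j.U (fderiv ℝ J j _), ← map_smul, ← map_add]
  congr 1
  ext i
  fin_cases i <;> simp [eulerDirection, Ut, ρt, St] <;> ring

theorem isInvariantOn_iff_eulerDirection (hW : IsOpen W)
    (hp : ContDiffOn ℝ 2 (Function.uncurry p) W) (hWpos : ∀ z ∈ W, 0 < z.1)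
    (hDW : D ⊆ jetsOver W) :
    IsInvariantOn p n D J ↔ ContDiffOn ℝ 1 J D ∧
      ∀ j ∈ D, ∀ a b c : ℝ, fderiv ℝ J j (eulerDirection p n j a b c) = 0 := by
  refine and_congr_right fun _ => forall₂_congr fun j hj => forall₃_congr fun a b c => ?_
  rw [totalDt_add_mul_totalDr hW hp (hDW hj) (hWpos _ (hDW hj).2).ne']

/-- The determining equations of the scalar invariants, for an equation of state one of whose
partial derivatives vanishes on no open set. -/
theorem IsInvariantOn.determining_equations (hW : IsOpen W)
    (hp : ContDiffOn ℝ 2 (Function.uncurry p) W) (hWpos : ∀ z ∈ W, 0 < z.1)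
    (hDW : D ⊆ jetsOver W) (hD : IsOpen D) {q : ℝ → ℝ → ℝ} (hq : q = dRho p ∨ q = dS p)
    (hq0 : ∀ V ⊆ W, IsOpen V → V.Nonempty → ∃ z ∈ V, q z.1 z.2 ≠ 0)
    (hJ : IsInvariantOn p n D J) :
    ∀ j ∈ D, jetPartial J 5 j = 0 ∧ jetPartial J 6 j = 0 ∧
      j.ρ * jetPartial J 3 j + j.Sr * jetPartial J 7 j = 0 ∧
      jetPartial J 2 j * dRho p j.ρ j.S = 0 ∧
      jetPartial J 0 j + j.U * jetPartial J 1 j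
        - dS p j.ρ j.S * j.Sr / j.ρ * jetPartial J 2 j
        - ((n : ℝ) - 1) / j.r * j.U * j.ρ * jetPartial J 3 j = 0 := by
  obtain ⟨hJ1, hinv⟩ := (isInvariantOn_iff_eulerDirection hW hp hWpos hDW).1 hJ
  have hρ : ∀ j ∈ D, j.ρ ≠ 0 := fun j hj => (hWpos _ (hDW hj).2).ne'
  have hsum : ∀ j ∈ D, ∀ a b c : ℝ, _ := fun j hj a b c => by
    have := hinv j hj a b c
    rw [fderiv_jet_apply, Fin.sum_univ_eight] at this
    simp [eulerDirection] at this
    exact this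
  -- Subtracting the instances at `U_rr = 0` and `U_rr = 1` isolates the coefficient of `U_rr`; the
  -- same device is used next for `ρ_rr` and `S_rr`.
  have h6 : ∀ j ∈ D, jetPartial J 6 j = 0 := fun j hj => by
    have e1 := hsum j hj 0 0 0
    have e2 := hsum j hj 1 0 0
    have : j.ρ * jetPartial J 6 j = 0 := by simp at e1; linear_combination e1 - e2
    exact (mul_eq_zero.1 this).resolve_left (hρ j hj)
  have h5 : ∀ j ∈ D, jetPartial J 5 j = 0 := by
    refine eq_zero_of_mul_state_eq_zero hD hW hDW (continuousOn_jetPartial hD hJ1 5) hq0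
      fun j hj => ?_
    have e1 := hsum j hj 0 0 0
    have e2 := hsum j hj 0 1 0
    have e3 := hsum j hj 0 0 1
    have hρj := hρ j hj
    rcases hq with rfl | rfl
    · have : jetPartial J 5 j * (dRho p j.ρ j.S / j.ρ) = 0 := by
        simp at e1 e2; linear_combination e1 - e2
      field_simp at this
      simpa using this
    · have : jetPartial J 5 j * (dS p j.ρ j.S / j.ρ) = 0 := by
        simp at e1 e3; linear_combination e1 - e3
      field_simp at this
      simpa using this
  have htr : ∀ j ∈ D, jetPartial J 0 j + j.U * jetPartial J 1 j
      - (dS p j.ρ j.S * j.Sr + dRho p j.ρ j.S * j.ρr) / j.ρ * jetPartial J 2 j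
      - (j.Ur * j.ρ + ((n : ℝ) - 1) / j.r * j.U * j.ρ) * jetPartial J 3 j
      - j.Ur * j.Sr * jetPartial J 7 j = 0 := fun j hj => by
    have e1 := hsum j hj 0 0 0
    rw [h5 j hj, h6 j hj] at e1
    linear_combination e1
  -- A nonzero shift in `U_r` or `ρ_r` changes none of the partials of `J`. Since `htr` is affine in
  -- these coordinates, subtracting its shifted version extracts their coefficients.
  have htranslate : ∀ i : Fin 8, (∀ j ∈ D, jetPartial J i j = 0) → ∀ j ∈ D, ∃ s : ℝ, s ≠ 0 ∧
      j + s • Pi.single i 1 ∈ D ∧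
        ∀ k, jetPartial J k (j + s • Pi.single i 1) = jetPartial J k j := by
    intro i hi j hj
    have h1 := eventually_fderiv_translate hD hJ1 hi hj
    obtain ⟨s, ⟨h2, h3⟩, h4⟩ := ((h1.filter_mono nhdsWithin_le_nhds).and
      (self_mem_nhdsWithin (s := {0}ᶜ))).exists (f := 𝓝[≠] (0 : ℝ))
    exact ⟨s, h4, h2, fun k => by rw [jetPartial, h3, jetPartial]⟩
  intro j hj
  have e0 := htr j hj
  have hρj := hρ j hj
  have e3 : j.ρ * jetPartial J 3 j + j.Sr * jetPartial J 7 j = 0 := by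
    obtain ⟨s, hs, hsD, hsJ⟩ := htranslate 5 h5 j hj
    have e1 := htr _ hsD
    simp only [hsJ] at e1
    simp [Jet.U, Jet.Ur, Jet.ρ, Jet.r, Jet.S, Jet.Sr, Jet.ρr] at e1 e0
    have : s * (j.ρ * jetPartial J 3 j + j.Sr * jetPartial J 7 j) = 0 := by
      simp only [Jet.ρ, Jet.Sr]
      linear_combination e0 - e1
    exact (mul_eq_zero.1 this).resolve_left hs
  have e2 : jetPartial J 2 j * dRho p j.ρ j.S = 0 := by
    obtain ⟨s, hs, hsD, hsJ⟩ := htranslate 6 h6 j hj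
    have e1 := htr _ hsD
    simp only [hsJ] at e1
    simp [Jet.U, Jet.Ur, Jet.ρ, Jet.r, Jet.S, Jet.Sr, Jet.ρr] at e1 e0
    have : s / j.ρ * (jetPartial J 2 j * dRho p j.ρ j.S) = 0 := by
      simp only [Jet.ρ, Jet.S]
      linear_combination e0 - e1
    exact (mul_eq_zero.1 this).resolve_left (div_ne_zero hs hρj)
  refine ⟨h5 j hj, h6 j hj, e3, e2, ?_⟩
  linear_combination e0 + j.Ur * e3 + j.ρr / j.ρ * e2

end Euler

/-! ### The chart straightening `S` and the entropy gradient -/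

/-- The jet with prescribed values `x` of `S` and `r^{1-n} S_r / ρ` and prescribed values `y` of
`(t, r, U, ρ, U_r, ρ_r)`. -/
def basicSection (n : ℕ) (z : (Fin 2 → ℝ) × (Fin 6 → ℝ)) : Jet :=
  ![z.2 0, z.2 1, z.2 2, z.2 3, z.1 0, z.2 4, z.2 5, z.1 1 * z.2 3 * z.2 1 ^ (n - 1)]

/-- The fibre coordinates `(t, r, U, ρ, U_r, ρ_r)`. -/
def basicFibre (j : Jet) : Fin 6 → ℝ := ![j.t, j.r, j.U, j.ρ, j.Ur, j.ρr]

/-- The coordinate domain corresponding to `jetsOver (R ×ˢ I)`. -/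
def basicTarget (R I : Set ℝ) : Set ((Fin 2 → ℝ) × (Fin 6 → ℝ)) :=
  {z | 0 < z.2 1 ∧ z.2 3 ∈ R ∧ z.1 0 ∈ I}

theorem contDiff_basicSection (n : ℕ) : ContDiff ℝ 1 (basicSection n) := by
  refine contDiff_pi.2 fun i => ?_
  fin_cases i <;> simp [basicSection] <;> fun_prop

theorem fderiv_basicSection {n : ℕ} (hn : 2 ≤ n) (z : (Fin 2 → ℝ) × (Fin 6 → ℝ))
    (v : Fin 6 → ℝ) :
    fderiv ℝ (basicSection n) z (0, v) =
      ![v 0, v 1, v 2, v 3, 0, v 4, v 5,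
        z.1 1 * (v 3 * z.2 1 ^ (n - 1) + z.2 3 * (((n : ℝ) - 1) * z.2 1 ^ (n - 2) * v 1))] := by
  obtain ⟨m, rfl⟩ := Nat.exists_eq_add_of_le hn
  refine fderiv_eq_of_hasDerivAt_line
    ((contDiff_basicSection _).differentiable one_ne_zero z) ?_
  have hl : ∀ i, HasDerivAt (fun s : ℝ => z.2 i + s * v i) (v i) 0 := fun i => by
    simpa using ((hasDerivAt_id (0 : ℝ)).mul_const (v i)).const_add (z.2 i)
  refine hasDerivAt_pi.2 fun i => ?_
  fin_cases i <;> simp [basicSection, hl, hasDerivAt_const]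
  have h1 := (((hl 3).const_mul (z.1 1)).mul ((hl 1).pow (1 + m)))
  refine h1.congr_deriv ?_
  rw [show 1 + m = m + 1 by omega]
  simp
  ring

theorem entropyGradient_eq {n : ℕ} (hn : 2 ≤ n) (j : Jet) :
    entropyGradient n j = j.Sr / (j.ρ * j.r ^ (n - 1)) := by
  rw [entropyGradient, show (1 - (n : ℤ)) = -((n - 1 : ℕ) : ℤ) by omega, zpow_neg, zpow_natCast]
  field_simp

theorem contDiffOn_basicInvariants {n : ℕ} (hn : 2 ≤ n) {W : Set (ℝ × ℝ)}
    (hWpos : ∀ z ∈ W, 0 < z.1) : ContDiffOn ℝ 1 (basicInvariants n) (jetsOver W) := by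
  have h2 : ContDiffOn ℝ 1 (entropyGradient n) (jetsOver W) := by
    rw [funext (entropyGradient_eq hn)]
    refine ContDiffOn.div ?_ ?_ fun j hj =>
      mul_ne_zero (hWpos _ hj.2).ne' (pow_ne_zero _ hj.1.ne')
    · exact (contDiff_apply ℝ ℝ (7 : Fin 8)).contDiffOn
    · unfold Jet.ρ Jet.r
      fun_prop
  refine contDiffOn_pi.2 fun i => ?_
  fin_cases i
  · exact (contDiff_apply ℝ ℝ (4 : Fin 8)).contDiffOn
  · exact h2

section Basic

variable {n : ℕ} {R I : Set ℝ}

theorem isFibredChart_basic (hn : 2 ≤ n) (hRo : IsOpen R) (hR : R.OrdConnected)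
    (hRpos : R ⊆ Ioi 0) (hIo : IsOpen I) :
    IsFibredChart (basicInvariants n) basicFibre (basicSection n) (jetsOver (R ×ˢ I))
      (basicTarget R I) where
  isOpen_source := isOpen_jetsOver (hRo.prod hIo)
  isOpen_target := by
    refine IsOpen.inter ?_ (IsOpen.inter ?_ ?_)
    · exact isOpen_Ioi.preimage (f := fun z : (Fin 2 → ℝ) × (Fin 6 → ℝ) => z.2 1) (by fun_prop)
    · exact hRo.preimage (f := fun z : (Fin 2 → ℝ) × (Fin 6 → ℝ) => z.2 3) (by fun_prop)
    · exact hIo.preimage (f := fun z : (Fin 2 → ℝ) × (Fin 6 → ℝ) => z.1 0) (by fun_prop)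
  mem_target := fun j hj => ⟨hj.1, hj.2.1, hj.2.2⟩
  mem_source := fun z hz => ⟨hz.1, hz.2.1, hz.2.2⟩
  left_inv := fun j hj => by
    have h1 : j.ρ ≠ 0 := (hRpos hj.2.1).ne'
    have h2 : j.r ≠ 0 := hj.1.ne'
    have h3 : entropyGradient n j * j.ρ * j.r ^ (n - 1) = j.Sr := by
      rw [entropyGradient_eq hn]
      field_simp
    ext i
    fin_cases i <;> simp [basicSection, basicInvariants, basicFibre, h3] <;> rfl
  right_inv := fun z hz => by
    have h1 : z.2 3 ≠ 0 := (hRpos hz.2.1).ne'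
    have h2 : z.2 1 ≠ 0 := hz.1.ne'
    ext i
    fin_cases i
    · simp [basicSection, basicInvariants, Jet.S]
    · simp [basicInvariants, entropyGradient_eq hn, basicSection, Jet.Sr, Jet.ρ, Jet.r]
      field_simp
  contDiffOn_quantities := contDiffOn_basicInvariants hn fun z hz => hRpos hz.1
  continuousOn_fibre := by
    refine (continuous_pi fun i => ?_).continuousOn
    fin_cases i <;> exact continuous_apply _
  contDiffOn_symm := (contDiff_basicSection n).contDiffOn
  convex_fibre := fun x y hy y' hy' a b ha hb hab =>
    ⟨convex_Ioi (0 : ℝ) hy.1 hy'.1 ha hb hab, hR.convex hy.2.1 hy'.2.1 ha hb hab, hy.2.2⟩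

/-! ### Invariants when `p_ρ` vanishes on no open set -/

theorem exists_fderiv_basicSection_eq (hn : 2 ≤ n) {z : (Fin 2 → ℝ) × (Fin 6 → ℝ)} {w : Jet}
    (h4 : w 4 = 0) (h7 : w 7 = z.1 1 * (w 3 * z.2 1 ^ (n - 1) +
      z.2 3 * (((n : ℝ) - 1) * z.2 1 ^ (n - 2) * w 1))) :
    ∃ v, w = fderiv ℝ (basicSection n) z (0, v) := by
  refine ⟨![w 0, w 1, w 2, w 3, w 5, w 6], ?_⟩
  rw [fderiv_basicSection hn]
  ext i
  fin_cases i <;> simp [h4, h7]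

/-- Tangency to the fibres expresses that `S` and `r^{1-n} S_r / ρ` are themselves invariants,
whatever the equation of state. -/
theorem eulerDirection_basicSection (hn : 2 ≤ n) (p : ℝ → ℝ → ℝ) (hRpos : R ⊆ Ioi 0)
    {z : (Fin 2 → ℝ) × (Fin 6 → ℝ)} (hz : z ∈ basicTarget R I) (a b c : ℝ) :
    ∃ v, eulerDirection p n (basicSection n z) a b c = fderiv ℝ (basicSection n) z (0, v) := by
  have h1 : z.2 3 ≠ 0 := (hRpos hz.2.1).ne'
  have h2 : z.2 1 ≠ 0 := hz.1.ne'
  refine exists_fderiv_basicSection_eq hn rfl ?_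
  obtain ⟨m, rfl⟩ := Nat.exists_eq_add_of_le hn
  simp [eulerDirection, basicSection, Jet.Sr, Jet.ρ, Jet.r, Jet.Ur, Jet.U]
  rw [show 1 + m = m + 1 by omega]
  field_simp
  ring

/-- Where `p_ρ` vanishes on no open set, invariants are constant along the fibres of `S` and the
entropy gradient. -/
theorem IsInvariantOn.isVerticallyConstantOn_basic (hn : 2 ≤ n) {p : ℝ → ℝ → ℝ}
    {W : Set (ℝ × ℝ)} (hW : IsOpen W) (hp : ContDiffOn ℝ 2 (Function.uncurry p) W)
    (hWpos : ∀ z ∈ W, 0 < z.1)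
    (hq0 : ∀ V ⊆ W, IsOpen V → V.Nonempty → ∃ z ∈ V, dRho p z.1 z.2 ≠ 0)
    {D : Set Jet} (hDW : D ⊆ jetsOver W) (hD : IsOpen D) {J : Jet → ℝ}
    (hJ : IsInvariantOn p n D J) :
    IsVerticallyConstantOn (basicSection n) (basicTarget R I) D J := by
  have hdet := hJ.determining_equations hW hp hWpos hDW hD (Or.inl rfl) hq0
  have h2 : ∀ j ∈ D, jetPartial J 2 j = 0 :=
    eq_zero_of_mul_state_eq_zero hD hW hDW (continuousOn_jetPartial hD hJ.1 2) hq0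
      fun j hj => (hdet j hj).2.2.2.1
  have htr : ∀ j ∈ D, jetPartial J 0 j + j.U * jetPartial J 1 j
      - ((n : ℝ) - 1) / j.r * j.U * j.ρ * jetPartial J 3 j = 0 := fun j hj => by
    have := (hdet j hj).2.2.2.2
    rw [h2 j hj] at this
    simpa using this
  -- Since `J_U = 0`, the partials of `J` are unchanged by a shift in `U`, while the transport
  -- equation is affine in `U`: the difference gives the coefficient of `U`.
  have hU : ∀ j ∈ D, jetPartial J 1 j - ((n : ℝ) - 1) / j.r * j.ρ * jetPartial J 3 j = 0 := by
    intro j hj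
    have h1 := eventually_fderiv_translate hD hJ.1 h2 hj
    obtain ⟨s, ⟨hsD, hs⟩, hs0⟩ := ((h1.filter_mono nhdsWithin_le_nhds).and
      (self_mem_nhdsWithin (s := {0}ᶜ))).exists (f := 𝓝[≠] (0 : ℝ))
    have e0 := htr j hj
    have e1 := htr _ hsD
    simp only [jetPartial, hs] at e1 e0 ⊢
    simp [Jet.U, Jet.r, Jet.ρ] at e0 e1 ⊢
    refine (mul_eq_zero.1 (?_ : s * _ = 0)).resolve_left hs0
    linear_combination e1 - e0
  intro z hz hzD v
  obtain ⟨h5, h6, h37, -, -⟩ := hdet _ hzD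
  have e1 := hU _ hzD
  have e0 := htr _ hzD
  have h0 : jetPartial J 0 (basicSection n z) = 0 := by
    linear_combination e0 - (basicSection n z).U * e1
  have hρ : z.2 3 ≠ 0 := (hWpos _ (hDW hzD).2).ne'
  have hr : z.2 1 ≠ 0 := hz.1.ne'
  rw [fderiv_basicSection hn, fderiv_jet_apply, Fin.sum_univ_eight]
  simp only [h0, h2 _ hzD, h5, h6]
  obtain ⟨m, rfl⟩ := Nat.exists_eq_add_of_le hn
  generalize jetPartial J 1 (basicSection (2 + m) z) = P1 at *
  generalize jetPartial J 3 (basicSection (2 + m) z) = P3 at *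
  generalize jetPartial J 7 (basicSection (2 + m) z) = P7 at *
  simp [basicSection, Jet.r, Jet.ρ, Jet.Sr] at h37 e1 ⊢
  have h3 : P3 = -(z.1 1 * z.2 1 ^ (1 + m) * P7) := by
    refine mul_left_cancel₀ hρ ?_
    linear_combination h37
  have h1 : P1 = (2 + (m : ℝ) - 1) / z.2 1 * z.2 3 * P3 := by linear_combination e1
  rw [h1, h3]
  field_simp
  ring

/-- The scalar invariants for an equation of state with `p_ρ` vanishing on no open set. -/
theorem isInvariantOn_iff_basic (hn : 2 ≤ n) {p : ℝ → ℝ → ℝ} (hRo : IsOpen R)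
    (hR : R.OrdConnected) (hRpos : R ⊆ Ioi 0) (hIo : IsOpen I)
    (hp : ContDiffOn ℝ 2 (Function.uncurry p) (R ×ˢ I))
    (hq0 : ∀ V ⊆ R ×ˢ I, IsOpen V → V.Nonempty → ∃ z ∈ V, dRho p z.1 z.2 ≠ 0) :
    (∀ J, IsInvariantOn p n (jetsOver (R ×ˢ I)) J ↔
      IsFunctionOf (basicInvariants n) J (jetsOver (R ×ˢ I))) ∧
    (∀ D ⊆ jetsOver (R ×ˢ I), IsOpen D → ∀ J,
      IsInvariantOn p n D J ↔ IsLocallyFunctionOf (basicInvariants n) J D) := by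
  have hc := isFibredChart_basic hn hRo hR hRpos hIo
  have hpos : ∀ z ∈ R ×ˢ I, 0 < z.1 := fun z hz => hRpos hz.1
  refine hc.isInvariantOn_iff fun D hDD hD J hJ => ⟨fun h =>
    h.isVerticallyConstantOn_basic hn (hRo.prod hIo) hp hpos hq0 hDD hD, fun h =>
    (isInvariantOn_iff_eulerDirection (hRo.prod hIo) hp hpos hDD).2 ⟨hJ, fun j hj a b c => ?_⟩⟩
  have hz := hc.mem_target j (hDD hj)
  have hjz := hc.left_inv j (hDD hj)
  obtain ⟨v, hv⟩ := eulerDirection_basicSection hn p hRpos hz a b c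
  have := h _ hz (by rwa [hjz]) v
  rwa [← hv, hjz] at this

/-- The chart over the whole of `R ×ˢ I` serves for every open `W`, product or not, because the
local factorization only needs an open set inside the chart domain. -/
theorem not_hasAdditionalInvariant (hn : 2 ≤ n) {p : ℝ → ℝ → ℝ} (hRo : IsOpen R)
    (hR : R.OrdConnected) (hRpos : R ⊆ Ioi 0) (hIo : IsOpen I)
    (hp : ContDiffOn ℝ 2 (Function.uncurry p) (R ×ˢ I)) {W : Set (ℝ × ℝ)} (hW : IsOpen W)
    (hWR : W ⊆ R ×ˢ I)
    (hq0 : ∀ V ⊆ W, IsOpen V → V.Nonempty → ∃ z ∈ V, dRho p z.1 z.2 ≠ 0) :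
    ¬ HasAdditionalInvariant p n W := by
  rintro ⟨D, J, hD, hDW, hJ, hne⟩
  have hDD : D ⊆ jetsOver (R ×ˢ I) := fun j hj => ⟨(hDW hj).1, hWR (hDW hj).2⟩
  exact hne ((isFibredChart_basic hn hRo hR hRpos hIo).isLocallyFunctionOf hDD hD hJ.1
    (hJ.isVerticallyConstantOn_basic hn hW (hp.mono hWR) (fun z hz => hRpos (hWR hz).1) hq0 hDW hD))

end Basic

/-! ### Entropic equations of state -/

section Entropic

variable {n : ℕ} {R I : Set ℝ} {p : ℝ → ℝ → ℝ} {κ : ℝ → ℝ}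

theorem exists_eq_entropy (hRo : IsOpen R) (hR : R.OrdConnected) (hR0 : R.Nonempty)
    (hIo : IsOpen I) (hp : ContDiffOn ℝ 2 (Function.uncurry p) (R ×ˢ I))
    (h : ∀ z ∈ R ×ˢ I, dRho p z.1 z.2 = 0) : ∃ κ : ℝ → ℝ, ∀ ρ ∈ R, ∀ S ∈ I, p ρ S = κ S := by
  obtain ⟨ρ₀, hρ₀⟩ := hR0
  refine ⟨p ρ₀, fun ρ hρ S hS => ?_⟩
  have key : ∀ x ∈ R, HasDerivWithinAt (fun x => p x S) 0 R x := fun x hx => by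
    have hz : (x, S) ∈ R ×ˢ I := ⟨hx, hS⟩
    have h1 : HasDerivAt (fun x : ℝ => (x, S)) ((1 : ℝ), (0 : ℝ)) x :=
      (hasDerivAt_id x).prodMk (hasDerivAt_const _ _)
    have h2 := (hasFDerivAt_state (hRo.prod hIo) hp hz).comp_hasDerivAt x h1
    rw [← dRho_eq_fderiv (hRo.prod hIo) hp hz, h _ hz] at h2
    exact h2.hasDerivWithinAt
  have := hR.convex.norm_image_sub_le_of_norm_hasDerivWithin_le (C := 0) key (by simp) hρ₀ hρ
  simpa [sub_eq_zero] using this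

theorem contDiffOn_entropy (hR0 : R.Nonempty) (hp : ContDiffOn ℝ 2 (Function.uncurry p) (R ×ˢ I))
    (hκ : ∀ ρ ∈ R, ∀ S ∈ I, p ρ S = κ S) : ContDiffOn ℝ 2 κ I := by
  obtain ⟨ρ₀, hρ₀⟩ := hR0
  have h1 : ContDiffOn ℝ 2 (fun s : ℝ => (ρ₀, s)) I := by fun_prop
  exact (hp.comp h1 fun s hs => ⟨hρ₀, hs⟩).congr fun s hs => (hκ ρ₀ hρ₀ s hs).symm

theorem contDiffOn_deriv_entropy (hIo : IsOpen I) (hκ : ContDiffOn ℝ 2 κ I) :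
    ContDiffOn ℝ 1 (deriv κ) I :=
  hκ.deriv_of_isOpen hIo (by norm_num)

theorem dS_eq_deriv_entropy (hIo : IsOpen I) (hκ : ∀ ρ ∈ R, ∀ S ∈ I, p ρ S = κ S) {ρ S : ℝ}
    (hρ : ρ ∈ R) (hS : S ∈ I) : dS p ρ S = deriv κ S :=
  Filter.EventuallyEq.deriv_eq (by filter_upwards [hIo.mem_nhds hS] with s hs using hκ ρ hρ s hs)

theorem dRho_eq_zero (hRo : IsOpen R) (hκ : ∀ ρ ∈ R, ∀ S ∈ I, p ρ S = κ S) {ρ S : ℝ}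
    (hρ : ρ ∈ R) (hS : S ∈ I) : dRho p ρ S = 0 := by
  have : (fun x => p x S) =ᶠ[𝓝 ρ] fun _ => κ S := by
    filter_upwards [hRo.mem_nhds hρ] with x hx using hκ x hx S hS
  rw [dRho, this.deriv_eq, deriv_const]

theorem contDiffOn_energyInvariant (hRpos : R ⊆ Ioi 0)
    (hκ : ContDiffOn ℝ 1 (deriv κ) I) :
    ContDiffOn ℝ 1 (energyInvariant κ n) (jetsOver (R ×ˢ I)) := by
  have h1 : ContDiffOn ℝ 1 (fun j : Jet => deriv κ j.S) (jetsOver (R ×ˢ I)) :=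
    hκ.comp (t := I) (contDiff_apply ℝ ℝ (4 : Fin 8)).contDiffOn fun j hj => hj.2.2
  have h2 : ∀ j ∈ jetsOver (R ×ˢ I), j.ρ ≠ 0 := fun j hj => (hRpos hj.2.1).ne'
  unfold energyInvariant
  unfold Jet.ρ at *
  unfold Jet.U Jet.r Jet.Sr
  fun_prop (disch := assumption)

/-- Along the flow `r S_r / ρ` has derivative `n U S_r / ρ`, the terms in `U_r` cancelling, while
`U²` has derivative `-2 U κ'(S) S_r / ρ`; the factor `2/n` balances the two. -/
theorem isInvariantOn_energyInvariant (hn : 2 ≤ n) (hRo : IsOpen R) (hR0 : R.Nonempty)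
    (hRpos : R ⊆ Ioi 0) (hIo : IsOpen I) (hp : ContDiffOn ℝ 2 (Function.uncurry p) (R ×ˢ I))
    (hκ : ∀ ρ ∈ R, ∀ S ∈ I, p ρ S = κ S) :
    IsInvariantOn p n (jetsOver (R ×ˢ I)) (energyInvariant κ n) := by
  have hC := contDiffOn_energyInvariant (n := n) hRpos
    (contDiffOn_deriv_entropy hIo (contDiffOn_entropy hR0 hp hκ))
  have hW := hRo.prod hIo
  refine (isInvariantOn_iff_eulerDirection hW hp (fun z hz => hRpos hz.1) subset_rfl).2
    ⟨hC, fun j hj a b c => ?_⟩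
  have hρ : j.ρ ≠ 0 := (hRpos hj.2.1).ne'
  have hr : j.r ≠ 0 := hj.1.ne'
  have hn0 : (n : ℝ) ≠ 0 := by positivity
  refine fderiv_eq_of_hasDerivAt_line
    (differentiableAt_of_contDiffOn (isOpen_jetsOver hW) hC hj) ?_
  set w := eulerDirection p n j a b c with hw
  have hl : ∀ i, HasDerivAt (fun s : ℝ => (j + s • w) i) (w i) 0 := fun i => by
    simpa using ((hasDerivAt_id (0 : ℝ)).mul_const (w i)).const_add (j i)
  -- The direction has no `S` component, so `κ'(S)` is a constant along the line and is not
  -- differentiated.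
  have hS : ∀ s : ℝ, (j + s • w).S = j.S := fun s => by simp [Jet.S, hw, eulerDirection]
  have h3 := ((hl 2).pow 2).add
    (((((hl 1).const_mul (2 / (n : ℝ))).mul_const (deriv κ j.S)).mul (hl 7)).div (hl 3)
      (by rw [zero_smul, add_zero]; exact hρ))
  unfold energyInvariant
  simp only [hS]
  refine h3.congr_deriv ?_
  have hdS := dS_eq_deriv_entropy hIo hκ hj.2.1 hj.2.2
  have hdR := dRho_eq_zero hRo hκ hj.2.1 hj.2.2
  simp only [hw, eulerDirection, hdS, hdR]
  simp [Jet.U, Jet.Ur, Jet.ρ, Jet.r, Jet.Sr]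
  unfold Jet.ρ Jet.r at *
  field_simp
  ring

theorem IsInvariantOn.mono {J : Jet → ℝ} {D D' : Set Jet} (h : IsInvariantOn p n D J)
    (hD : D' ⊆ D) : IsInvariantOn p n D' J :=
  ⟨h.1.mono hD, fun j hj => h.2 j (hD hj)⟩

theorem not_isLocallyFunctionOf_energyInvariant {W : Set (ℝ × ℝ)} (hW0 : W.Nonempty) :
    ¬ IsLocallyFunctionOf (basicInvariants n) (energyInvariant κ n) (jetsOver W) := by
  intro h
  obtain ⟨⟨ρ, S⟩, hz⟩ := hW0
  -- At `S_r = 0` a change of `U` fixes both basic invariants but changes the energy, which is `U²`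
  -- there.
  let m : ℝ → Jet := fun s => ![0, 1, s, ρ, S, 0, 0, 0]
  have hm : Continuous m := by
    refine continuous_pi fun i => ?_
    fin_cases i <;> simp [m] <;> fun_prop
  obtain ⟨f, -, hf⟩ := h (m 1) ⟨by simp [m, Jet.r], by simpa [m, Jet.ρ, Jet.S] using hz⟩
  have h1 := (hm.continuousAt.eventually hf).filter_mono (nhdsWithin_le_nhds (s := Ioi 1))
  obtain ⟨s, hs, hs1⟩ := (h1.and self_mem_nhdsWithin).exists
  have h0 := hf.self_of_nhds
  have hb : basicInvariants n (m s) = basicInvariants n (m 1) := by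
    simp [m, basicInvariants, entropyGradient, Jet.S, Jet.Sr]
  rw [hb, ← h0] at hs
  simp [m, energyInvariant, Jet.U, Jet.Sr] at hs
  have : (1 : ℝ) < s := hs1
  rcases hs with hs | hs <;> linarith

theorem hasAdditionalInvariant_of_entropic (hn : 2 ≤ n) (hRo : IsOpen R) (hR0 : R.Nonempty)
    (hRpos : R ⊆ Ioi 0) (hIo : IsOpen I) (hp : ContDiffOn ℝ 2 (Function.uncurry p) (R ×ˢ I))
    (hκ : ∀ ρ ∈ R, ∀ S ∈ I, p ρ S = κ S) {W : Set (ℝ × ℝ)} (hW : IsOpen W) (hW0 : W.Nonempty)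
    (hWR : W ⊆ R ×ˢ I) : HasAdditionalInvariant p n W :=
  ⟨jetsOver W, energyInvariant κ n, isOpen_jetsOver hW, subset_rfl,
    (isInvariantOn_energyInvariant hn hRo hR0 hRpos hIo hp hκ).mono
      fun _ hj => ⟨hj.1, hWR hj.2⟩,
    not_isLocallyFunctionOf_energyInvariant hW0⟩

theorem isEntropic_of_dRho_eq_zero (hRo : IsOpen R) (hR : R.OrdConnected) (hR0 : R.Nonempty)
    (hIo : IsOpen I) (hp : ContDiffOn ℝ 2 (Function.uncurry p) (R ×ˢ I))
    (hne : ∃ x ∈ R ×ˢ I, ∃ y ∈ R ×ˢ I, p x.1 x.2 ≠ p y.1 y.2)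
    (h : ∀ z ∈ R ×ˢ I, dRho p z.1 z.2 = 0) : IsEntropic p R I := by
  obtain ⟨κ, hκ⟩ := exists_eq_entropy hRo hR hR0 hIo hp h
  obtain ⟨x, hx, y, hy, hxy⟩ := hne
  refine ⟨κ, ⟨x.2, hx.2, y.2, hy.2, ?_⟩, hκ⟩
  rwa [hκ _ hx.1 _ hx.2, hκ _ hy.1 _ hy.2] at hxy

theorem forall_hasAdditionalInvariant_iff (hn : 2 ≤ n) (hRo : IsOpen R) (hR : R.OrdConnected)
    (hR0 : R.Nonempty) (hRpos : R ⊆ Ioi 0) (hIo : IsOpen I)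
    (hp : ContDiffOn ℝ 2 (Function.uncurry p) (R ×ˢ I))
    (hne : ∃ x ∈ R ×ˢ I, ∃ y ∈ R ×ˢ I, p x.1 x.2 ≠ p y.1 y.2) :
    (∀ W ⊆ R ×ˢ I, IsOpen W → W.Nonempty → HasAdditionalInvariant p n W) ↔ IsEntropic p R I := by
  refine ⟨fun h => isEntropic_of_dRho_eq_zero hRo hR hR0 hIo hp hne ?_,
    fun ⟨κ, _, hκ⟩ W hWR hW hW0 =>
      hasAdditionalInvariant_of_entropic hn hRo hR0 hRpos hIo hp hκ hW hW0 hWR⟩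
  intro z hz
  by_contra hz0
  have hW : IsOpen ((R ×ˢ I) ∩ (fun z : ℝ × ℝ => dRho p z.1 z.2) ⁻¹' {0}ᶜ) :=
    (contDiffOn_dRho (hRo.prod hIo) hp).continuousOn.isOpen_inter_preimage (hRo.prod hIo)
      isOpen_compl_singleton
  exact not_hasAdditionalInvariant hn hRo hR hRpos hIo hp hW inter_subset_left
    (fun V hV _ ⟨x, hx⟩ => ⟨x, hx, (hV hx).2⟩) (h _ inter_subset_left hW ⟨z, hz, hz0⟩)

theorem hasAdditionalInvariant_iff_of_analytic (hn : 2 ≤ n) (hRo : IsOpen R)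
    (hR : R.OrdConnected) (hR0 : R.Nonempty) (hRpos : R ⊆ Ioi 0) (hIo : IsOpen I)
    (hI : I.OrdConnected) (hI0 : I.Nonempty)
    (hp : ContDiffOn ℝ 2 (Function.uncurry p) (R ×ˢ I))
    (hne : ∃ x ∈ R ×ˢ I, ∃ y ∈ R ×ˢ I, p x.1 x.2 ≠ p y.1 y.2)
    (han : AnalyticOnNhd ℝ (Function.uncurry p) (R ×ˢ I)) :
    HasAdditionalInvariant p n (R ×ˢ I) ↔ IsEntropic p R I := by
  have hW := hRo.prod hIo
  refine ⟨fun h => isEntropic_of_dRho_eq_zero hRo hR hR0 hIo hp hne ?_,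
    fun ⟨κ, _, hκ⟩ => hasAdditionalInvariant_of_entropic hn hRo hR0 hRpos hIo hp hκ hW
      (hR0.prod hI0) subset_rfl⟩
  -- If `p_ρ` vanished on no open set, additional invariants would be excluded; the identity theorem
  -- then spreads the zeros from `V` to the connected set `R ×ˢ I`.
  obtain ⟨V, hV, hVo, ⟨z₀, hz₀⟩, hV0⟩ : ∃ V ⊆ R ×ˢ I, IsOpen V ∧ V.Nonempty ∧
      ∀ z ∈ V, dRho p z.1 z.2 = 0 := by
    by_contra! hcon
    exact not_hasAdditionalInvariant hn hRo hR hRpos hIo hp hW subset_rfl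
      (fun V hV hVo hV0 => hcon V hV hVo hV0) h
  have hg : AnalyticOnNhd ℝ (fun z => fderiv ℝ (Function.uncurry p) z (1, 0)) (R ×ˢ I) :=
    fun z hz => ((ContinuousLinearMap.apply ℝ ℝ ((1 : ℝ), (0 : ℝ))).analyticAt _).comp
      (han.fderiv z hz)
  have hpre : IsPreconnected (R ×ˢ I) := (hR.convex.prod hI.convex).isPreconnected
  have hev : (fun z => fderiv ℝ (Function.uncurry p) z (1, 0)) =ᶠ[𝓝 z₀] 0 := by
    filter_upwards [hVo.mem_nhds hz₀] with z hz
    rw [← dRho_eq_fderiv hW hp (hV hz), hV0 z hz, Pi.zero_apply]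
  intro z hz
  rw [dRho_eq_fderiv hW hp hz]
  exact hg.eqOn_zero_of_preconnected_of_eventuallyEq_zero hpre (hV hz₀) hev hz

end Entropic

/-! ### Integrals depending on a parameter -/

/-- On a compact neighbourhood of the parameter times `[0, 1]` the derivative `f'` is bounded. This
constant dominates both the differentiation under the integral and the continuity of the resulting
derivative. -/
theorem contDiffOn_parametric_integral {f f' : ℝ → ℝ → ℝ} {V : Set ℝ} (hV : IsOpen V)
    (hf : ContinuousOn (Function.uncurry f) (V ×ˢ Icc 0 1))
    (hf' : ContinuousOn (Function.uncurry f') (V ×ˢ Icc 0 1))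
    (hd : ∀ z ∈ V, ∀ u ∈ Icc (0 : ℝ) 1, HasDerivAt (fun z => f z u) (f' z u) z) :
    ContDiffOn ℝ 1 (fun z => ∫ u in (0 : ℝ)..1, f z u) V := by
  have hI : uIoc (0 : ℝ) 1 ⊆ Icc 0 1 := by
    rw [uIoc_of_le zero_le_one]
    exact Ioc_subset_Icc_self
  have hcont : ∀ g : ℝ → ℝ → ℝ, ContinuousOn (Function.uncurry g) (V ×ˢ Icc 0 1) → ∀ z ∈ V,
      ContinuousOn (g z) (Icc 0 1) := fun g hg z hz =>
    hg.comp (f := fun u => (z, u)) (by fun_prop) fun u hu => ⟨hz, hu⟩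
  have hmeas : ∀ g : ℝ → ℝ → ℝ, ContinuousOn (Function.uncurry g) (V ×ˢ Icc 0 1) → ∀ z ∈ V,
      MeasureTheory.AEStronglyMeasurable (g z) (MeasureTheory.volume.restrict (uIoc 0 1)) :=
    fun g hg z hz => ((hcont g hg z hz).mono hI).aestronglyMeasurable measurableSet_uIoc
  have hloc : ∀ z₀ ∈ V, ∃ N ∈ 𝓝 z₀, N ⊆ V ∧ ∃ C, ∀ z ∈ N, ∀ u ∈ Icc (0 : ℝ) 1, ‖f' z u‖ ≤ C := by
    intro z₀ hz₀
    obtain ⟨ε, hε, hball⟩ := Metric.nhds_basis_closedBall.mem_iff.1 (hV.mem_nhds hz₀)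
    obtain ⟨C, hC⟩ := ((isCompact_closedBall z₀ ε).prod (isCompact_Icc (a := (0 : ℝ))
      (b := 1))).exists_bound_of_continuousOn (hf'.mono (prod_mono hball subset_rfl))
    exact ⟨_, Metric.closedBall_mem_nhds z₀ hε, hball, C, fun z hz u hu => hC (z, u) ⟨hz, hu⟩⟩
  have hderiv : ∀ z₀ ∈ V, HasDerivAt (fun z => ∫ u in (0 : ℝ)..1, f z u)
      (∫ u in (0 : ℝ)..1, f' z₀ u) z₀ := by
    intro z₀ hz₀
    obtain ⟨N, hN, hNV, C, hC⟩ := hloc z₀ hz₀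
    refine (intervalIntegral.hasDerivAt_integral_of_dominated_loc_of_deriv_le
      (bound := fun _ => C) hN ?_ ?_ (hmeas f' hf' z₀ hz₀) ?_ (by simp) ?_).2
    · filter_upwards [hV.mem_nhds hz₀] with z hz using hmeas f hf z hz
    · exact ContinuousOn.intervalIntegrable (by
        rw [uIcc_of_le zero_le_one]; exact hcont f hf z₀ hz₀)
    · exact Eventually.of_forall fun u hu z hz => hC z hz u (hI hu)
    · exact Eventually.of_forall fun u hu z hz => hd z (hNV hz) u (hI hu)
  rw [show (1 : WithTop ℕ∞) = 0 + 1 by simp, contDiffOn_succ_iff_deriv_of_isOpen hV]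
  refine ⟨fun z hz => (hderiv z hz).differentiableAt.differentiableWithinAt, by simp, ?_⟩
  refine contDiffOn_zero.2 (ContinuousOn.congr ?_ fun z hz => (hderiv z hz).deriv)
  intro z₀ hz₀
  obtain ⟨N, hN, hNV, C, hC⟩ := hloc z₀ hz₀
  refine (intervalIntegral.continuousAt_of_dominated_interval (bound := fun _ => C)
    ?_ ?_ (by simp) ?_).continuousWithinAt
  · filter_upwards [hV.mem_nhds hz₀] with z hz using hmeas f' hf' z hz
  · filter_upwards [hN] with z hz using Eventually.of_forall fun u hu => hC z hz u (hI hu)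
  · refine Eventually.of_forall fun u hu => ?_
    exact (hf'.comp (t := V ×ˢ Icc 0 1) (f := fun z => (z, u)) (by fun_prop)
      fun z hz => ⟨hz, hI hu⟩).continuousAt (hV.mem_nhds hz₀)

/-! ### The travel time -/

/-- The travel time integral `∫_0^r dy / √(a - c yⁿ)`. -/
def travelIntegral (n : ℕ) (a c r : ℝ) : ℝ := ∫ y in (0 : ℝ)..r, 1 / √(a - c * y ^ n)

/-- For either sign of `c`, the value lies between those at `0` and at `r`, by monotonicity of `yⁿ`.
This controls the radicand and also makes the fibres of the entropic chart convex. -/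
theorem sub_mul_pow_pos {n : ℕ} {a c r y : ℝ} (ha : 0 < a) (h : 0 < a - c * r ^ n) (hy : 0 ≤ y)
    (hyr : y ≤ r) : 0 < a - c * y ^ n := by
  have h1 : y ^ n ≤ r ^ n := pow_le_pow_left₀ hy hyr n
  have h2 : 0 ≤ y ^ n := pow_nonneg hy n
  rcases le_total c 0 with hc | hc
  · nlinarith [mul_nonneg (neg_nonneg.2 hc) h2]
  · nlinarith [mul_le_mul_of_nonneg_left h1 hc]

/-- The substitution `y = r u` fixes the interval and leaves a single parameter `c rⁿ / a` under the
integral, so smoothness in all variables reduces to a one-parameter integral. -/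
theorem travelIntegral_eq (n : ℕ) {a : ℝ} (ha : 0 < a) (c r : ℝ) :
    travelIntegral n a c r =
      r / √a * ∫ u in (0 : ℝ)..1, 1 / √(1 - c * r ^ n / a * u ^ n) := by
  have h1 := intervalIntegral.smul_integral_comp_mul_left (a := 0) (b := 1)
    (fun y => 1 / √(a - c * y ^ n)) r
  rw [mul_zero, mul_one] at h1
  rw [travelIntegral, ← h1, smul_eq_mul, div_eq_mul_one_div r, mul_assoc,
    ← intervalIntegral.integral_const_mul (1 / √a)]
  congr 1
  refine intervalIntegral.integral_congr fun u _ => ?_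
  rw [show a - c * (r * u) ^ n = a * (1 - c * r ^ n / a * u ^ n) by field_simp; ring,
    Real.sqrt_mul ha.le, one_div_mul_one_div]

theorem contDiffOn_normalized_travelIntegral (n : ℕ) :
    ContDiffOn ℝ 1 (fun z : ℝ => ∫ u in (0 : ℝ)..1, 1 / √(1 - z * u ^ n)) (Iio 1) := by
  have hpos : ∀ z ∈ Iio (1 : ℝ), ∀ u ∈ Icc (0 : ℝ) 1, 0 < 1 - z * u ^ n := fun z hz u hu =>
    sub_mul_pow_pos one_pos (r := 1) (by simpa using hz) hu.1 hu.2
  have hne : ∀ x ∈ Iio (1 : ℝ) ×ˢ Icc (0 : ℝ) 1, √(1 - x.1 * x.2 ^ n) ≠ 0 := fun x hx =>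
    (Real.sqrt_pos.2 (hpos _ hx.1 _ hx.2)).ne'
  have hsq : Continuous fun x : ℝ × ℝ => √(1 - x.1 * x.2 ^ n) := by fun_prop
  refine contDiffOn_parametric_integral
    (f' := fun z u => u ^ n / (2 * √(1 - z * u ^ n)) / √(1 - z * u ^ n) ^ 2) isOpen_Iio
    ?_ ?_ fun z hz u hu => ?_
  · exact continuousOn_const.div hsq.continuousOn hne
  · refine ContinuousOn.div (ContinuousOn.div (by fun_prop) (by fun_prop) ?_) (by fun_prop) ?_
    · exact fun x hx => mul_ne_zero two_ne_zero (hne x hx)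
    · exact fun x hx => pow_ne_zero 2 (hne x hx)
  · have h0 := hpos z hz u hu
    have h1 : HasDerivAt (fun z : ℝ => 1 - z * u ^ n) (-(u ^ n)) z := by
      simpa using ((hasDerivAt_id z).mul_const (u ^ n)).const_sub 1
    have h2 := (h1.sqrt h0.ne').inv (Real.sqrt_pos.2 h0).ne'
    simp only [one_div]
    refine h2.congr_deriv ?_
    ring

theorem contDiffAt_travelIntegral {n : ℕ} {E : Type*} [NormedAddCommGroup E] [NormedSpace ℝ E]
    {a c r : E → ℝ} {x : E} (ha : ContDiffAt ℝ 1 a x) (hc : ContDiffAt ℝ 1 c x)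
    (hr : ContDiffAt ℝ 1 r x) (ha0 : 0 < a x) (h : 0 < a x - c x * r x ^ n) :
    ContDiffAt ℝ 1 (fun x => travelIntegral n (a x) (c x) (r x)) x := by
  have hev : (fun x => travelIntegral n (a x) (c x) (r x)) =ᶠ[𝓝 x] fun x =>
      r x / √(a x) * ∫ u in (0 : ℝ)..1, 1 / √(1 - c x * r x ^ n / a x * u ^ n) := by
    filter_upwards [ha.continuousAt.eventually_mem (isOpen_Ioi.mem_nhds ha0)] with x' hx'
    exact travelIntegral_eq n hx' _ _
  refine ContDiffAt.congr_of_eventuallyEq ?_ hev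
  have hz : c x * r x ^ n / a x ∈ Iio (1 : ℝ) := by
    rw [mem_Iio, div_lt_one ha0]
    linarith
  have h1 : ContDiffAt ℝ 1 (fun x => c x * r x ^ n / a x) x :=
    (hc.mul (hr.pow n)).div ha ha0.ne'
  exact (hr.div (ha.sqrt ha0.ne') (Real.sqrt_pos.2 ha0).ne').mul
    (ContDiffAt.comp (g := fun z => ∫ u in (0 : ℝ)..1, 1 / √(1 - z * u ^ n)) x
      ((contDiffOn_normalized_travelIntegral n).contDiffAt (isOpen_Iio.mem_nhds hz)) h1)

theorem hasDerivAt_travelIntegral {n : ℕ} {a c r : ℝ} (ha : 0 < a) (hr : 0 ≤ r)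
    (h : 0 < a - c * r ^ n) :
    HasDerivAt (travelIntegral n a c) (1 / √(a - c * r ^ n)) r := by
  have hcont : ∀ y, 0 < a - c * y ^ n → ContinuousAt (fun y => 1 / √(a - c * y ^ n)) y :=
    fun y hy => continuousAt_const.div (by fun_prop) (Real.sqrt_pos.2 hy).ne'
  refine intervalIntegral.integral_hasDerivAt_right ?_ ?_ (hcont r h)
  · refine ContinuousOn.intervalIntegrable fun y hy => ContinuousAt.continuousWithinAt (hcont y ?_)
    rw [uIcc_of_le hr] at hy
    exact sub_mul_pow_pos ha h hy.1 hy.2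
  · refine ContinuousAt.stronglyMeasurableAtFilter (s := {y | 0 < a - c * y ^ n})
      (isOpen_lt (by fun_prop) (by fun_prop)) hcont r h

/-! ### The chart straightening the invariants of an entropic equation of state -/

/-- The coefficient `c = (2/n) κ'(S) E` of `rⁿ` in the energy, as a function of the values
`x = (S, E, …)` of the invariants. -/
def entropicCoeff (κ : ℝ → ℝ) (n : ℕ) (x : Fin 4 → ℝ) : ℝ := 2 / (n : ℝ) * deriv κ (x 0) * x 1

/-- The squared velocity as a function of the values of the invariants and of the radius. -/
def entropicSqVelocity (κ : ℝ → ℝ) (n : ℕ) (z : (Fin 4 → ℝ) × (Fin 4 → ℝ)) : ℝ :=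
  z.1 2 - entropicCoeff κ n z.1 * z.2 0 ^ n

/-- The jet with prescribed values `x` of the four invariants and prescribed values `y` of
`(r, ρ, U_r, ρ_r)`. -/
def entropicSection (κ : ℝ → ℝ) (n : ℕ) (σ : ℝ) (z : (Fin 4 → ℝ) × (Fin 4 → ℝ)) : Jet :=
  ![σ * travelIntegral n (z.1 2) (entropicCoeff κ n z.1) (z.2 0) - z.1 3, z.2 0,
    σ * √(entropicSqVelocity κ n z), z.2 1, z.1 0, z.2 2, z.2 3,
    z.1 1 * z.2 1 * z.2 0 ^ (n - 1)]

/-- The fibre coordinates `(r, ρ, U_r, ρ_r)`. -/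
def entropicFibre (j : Jet) : Fin 4 → ℝ := ![j.r, j.ρ, j.Ur, j.ρr]

/-- The coordinate domain corresponding to the travel region. -/
def entropicTarget (κ : ℝ → ℝ) (n : ℕ) (R I : Set ℝ) : Set ((Fin 4 → ℝ) × (Fin 4 → ℝ)) :=
  {z | (0 < z.2 0 ∧ z.2 1 ∈ R ∧ z.1 0 ∈ I ∧ 0 < z.1 2) ∧ 0 < entropicSqVelocity κ n z}

section EntropicChart

variable {n : ℕ} {R I : Set ℝ} {p : ℝ → ℝ → ℝ} {κ : ℝ → ℝ} {σ : ℝ}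

theorem mul_self_eq_one_of_sign (hσ : σ = 1 ∨ σ = -1) : σ * σ = 1 := by
  rcases hσ with rfl | rfl <;> norm_num

/-- The coefficient of `rⁿ` in the energy of a jet. -/
def jetCoeff (κ : ℝ → ℝ) (n : ℕ) (j : Jet) : ℝ :=
  2 / (n : ℝ) * deriv κ j.S * entropyGradient n j

theorem jetCoeff_mul_pow (hn : 2 ≤ n) {j : Jet} (hr : j.r ≠ 0) :
    jetCoeff κ n j * j.r ^ n = 2 / (n : ℝ) * j.r * deriv κ j.S * j.Sr / j.ρ := by
  obtain ⟨m, rfl⟩ := Nat.exists_eq_add_of_le hn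
  rw [jetCoeff, entropyGradient_eq hn, show 2 + m - 1 = m + 1 by omega,
    show 2 + m = m + 1 + 1 by omega, pow_succ _ (m + 1)]
  field_simp

theorem energyInvariant_eq (hn : 2 ≤ n) {j : Jet} (hr : j.r ≠ 0) :
    energyInvariant κ n j = j.U ^ 2 + jetCoeff κ n j * j.r ^ n := by
  rw [energyInvariant, jetCoeff_mul_pow hn hr]

theorem radicand_eq (hn : 2 ≤ n) {j : Jet} (hr : j.r ≠ 0) (y : ℝ) :
    radicand κ n j y = energyInvariant κ n j - jetCoeff κ n j * y ^ n := by
  have h1 : jetCoeff κ n j * y ^ n = (y / j.r) ^ n * (jetCoeff κ n j * j.r ^ n) := by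
    rw [div_pow]
    field_simp
  rw [h1, jetCoeff_mul_pow hn hr, radicand, energyInvariant]
  ring

theorem travelTime_eq (hn : 2 ≤ n) {j : Jet} (hr : j.r ≠ 0) :
    travelTime κ n j = travelIntegral n (energyInvariant κ n j) (jetCoeff κ n j) j.r := by
  simp only [travelTime, travelIntegral, radicand_eq hn hr]

/-- The radicand is monotone in `y`, equal to the energy at `y = 0` and to `U²` at `y = r`, so its
positivity need only be asked at `y = 0`. -/
theorem mem_travelRegion_iff (hn : 2 ≤ n) {W : Set (ℝ × ℝ)} {j : Jet} :
    j ∈ travelRegion κ n W σ ↔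
      j ∈ jetsOver W ∧ 0 < σ * j.U ∧ 0 < energyInvariant κ n j := by
  refine and_congr_right fun hj => and_congr_right fun hU => ?_
  have hr : j.r ≠ 0 := hj.1.ne'
  have hU0 : j.U ≠ 0 := right_ne_zero_of_mul hU.ne'
  have hn0 : n ≠ 0 := by omega
  refine ⟨fun h => ?_, fun h y hy => ?_⟩
  · simpa [radicand_eq hn hr, hn0] using h 0 ⟨le_rfl, hj.1.le⟩
  · rw [radicand_eq hn hr]
    refine sub_mul_pow_pos h ?_ hy.1 hy.2
    rw [energyInvariant_eq hn hr]
    have : 0 < j.U ^ 2 := by positivity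
    linarith

theorem isOpen_travelRegion (hn : 2 ≤ n) (hRo : IsOpen R) (hRpos : R ⊆ Ioi 0) (hIo : IsOpen I)
    (hκ : ContDiffOn ℝ 1 (deriv κ) I) : IsOpen (travelRegion κ n (R ×ˢ I) σ) := by
  have h1 : travelRegion κ n (R ×ˢ I) σ = {j | 0 < σ * j.U} ∩
      (jetsOver (R ×ˢ I) ∩ energyInvariant κ n ⁻¹' Ioi 0) := by
    ext j
    rw [mem_travelRegion_iff hn]
    simp only [mem_inter_iff, mem_ofPred_eq, mem_preimage, mem_Ioi]
    tauto
  rw [h1]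
  refine IsOpen.inter (isOpen_lt continuous_const ?_)
    ((contDiffOn_energyInvariant hRpos hκ).continuousOn.isOpen_inter_preimage
      (isOpen_jetsOver (hRo.prod hIo)) isOpen_Ioi)
  unfold Jet.U
  fun_prop

theorem contDiffOn_entropicCoeff (hκ : ContDiffOn ℝ 1 (deriv κ) I) :
    ContDiffOn ℝ 1 (fun z : (Fin 4 → ℝ) × (Fin 4 → ℝ) => entropicCoeff κ n z.1)
      {z | z.1 0 ∈ I} := by
  have h1 : ContDiffOn ℝ 1 (fun z : (Fin 4 → ℝ) × (Fin 4 → ℝ) => deriv κ (z.1 0))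
      {z | z.1 0 ∈ I} :=
    hκ.comp (f := fun z : (Fin 4 → ℝ) × (Fin 4 → ℝ) => z.1 0) (by fun_prop) fun z hz => hz
  unfold entropicCoeff
  fun_prop

theorem contDiffOn_entropicSqVelocity (hκ : ContDiffOn ℝ 1 (deriv κ) I) :
    ContDiffOn ℝ 1 (entropicSqVelocity κ n) {z | z.1 0 ∈ I} := by
  have h1 := contDiffOn_entropicCoeff (n := n) hκ
  unfold entropicSqVelocity
  fun_prop

theorem isOpen_entropicTarget (hRo : IsOpen R) (hIo : IsOpen I)
    (hκ : ContDiffOn ℝ 1 (deriv κ) I) : IsOpen (entropicTarget κ n R I) := by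
  refine ((contDiffOn_entropicSqVelocity hκ).continuousOn.mono fun z hz => ?_).isOpen_inter_preimage
    (?_ : IsOpen {z : (Fin 4 → ℝ) × (Fin 4 → ℝ) |
      0 < z.2 0 ∧ z.2 1 ∈ R ∧ z.1 0 ∈ I ∧ 0 < z.1 2}) isOpen_Ioi
  · exact hz.2.2.1
  · refine IsOpen.inter ?_ (IsOpen.inter ?_ (IsOpen.inter ?_ ?_))
    · exact isOpen_Ioi.preimage (f := fun z : (Fin 4 → ℝ) × (Fin 4 → ℝ) => z.2 0) (by fun_prop)
    · exact hRo.preimage (f := fun z : (Fin 4 → ℝ) × (Fin 4 → ℝ) => z.2 1) (by fun_prop)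
    · exact hIo.preimage (f := fun z : (Fin 4 → ℝ) × (Fin 4 → ℝ) => z.1 0) (by fun_prop)
    · exact isOpen_Ioi.preimage (f := fun z : (Fin 4 → ℝ) × (Fin 4 → ℝ) => z.1 2) (by fun_prop)

theorem contDiffOn_entropicSection (hIo : IsOpen I)
    (hκ : ContDiffOn ℝ 1 (deriv κ) I) :
    ContDiffOn ℝ 1 (entropicSection κ n σ) (entropicTarget κ n R I) := by
  have hI : IsOpen {z : (Fin 4 → ℝ) × (Fin 4 → ℝ) | z.1 0 ∈ I} :=
    hIo.preimage (f := fun z : (Fin 4 → ℝ) × (Fin 4 → ℝ) => z.1 0) (by fun_prop)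
  intro z hz
  refine ContDiffAt.contDiffWithinAt ?_
  have hc := (contDiffOn_entropicCoeff (n := n) hκ).contDiffAt (hI.mem_nhds hz.1.2.2.1)
  have hv := (contDiffOn_entropicSqVelocity (n := n) hκ).contDiffAt (hI.mem_nhds hz.1.2.2.1)
  have h1 : ContDiffAt ℝ 1 (fun z : (Fin 4 → ℝ) × (Fin 4 → ℝ) =>
      travelIntegral n (z.1 2) (entropicCoeff κ n z.1) (z.2 0)) z :=
    contDiffAt_travelIntegral (by fun_prop) hc (by fun_prop) hz.1.2.2.2 hz.2
  have h2 : ContDiffAt ℝ 1 (fun z => √(entropicSqVelocity κ n z)) z := hv.sqrt hz.2.ne'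
  refine contDiffAt_pi.2 fun i => ?_
  fin_cases i <;> simp [entropicSection] <;> fun_prop

theorem fderiv_entropicSection (hn : 2 ≤ n) (hRo : IsOpen R) (hIo : IsOpen I)
    (hκ : ContDiffOn ℝ 1 (deriv κ) I) {z : (Fin 4 → ℝ) × (Fin 4 → ℝ)}
    (hz : z ∈ entropicTarget κ n R I) (v : Fin 4 → ℝ) :
    fderiv ℝ (entropicSection κ n σ) z (0, v) =
      ![σ * (v 0 / √(entropicSqVelocity κ n z)), v 0,
        σ * (-(deriv κ (z.1 0) * z.1 1 * z.2 0 ^ (n - 1) * v 0) / √(entropicSqVelocity κ n z)),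
        v 1, 0, v 2, v 3,
        z.1 1 * (v 1 * z.2 0 ^ (n - 1) + z.2 1 * (((n : ℝ) - 1) * z.2 0 ^ (n - 2) * v 0))] := by
  have hn0 : (n : ℝ) ≠ 0 := by positivity
  refine fderiv_eq_of_hasDerivAt_line
    (((contDiffOn_entropicSection hIo hκ).contDiffAt
      ((isOpen_entropicTarget hRo hIo hκ).mem_nhds hz)).differentiableAt one_ne_zero) ?_
  have hl : ∀ i, HasDerivAt (fun s : ℝ => z.2 i + s * v i) (v i) 0 := fun i => by
    simpa using ((hasDerivAt_id (0 : ℝ)).mul_const (v i)).const_add (z.2 i)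
  have hl0 : z.2 0 + 0 * v 0 = z.2 0 := by ring
  have hT : HasDerivAt (fun s : ℝ =>
      travelIntegral n (z.1 2) (entropicCoeff κ n z.1) (z.2 0 + s * v 0))
      (v 0 / √(entropicSqVelocity κ n z)) 0 := by
    have h1 := hasDerivAt_travelIntegral (n := n) hz.1.2.2.2 hz.1.1.le hz.2
    rw [← hl0] at h1
    refine (h1.comp (0 : ℝ) (hl 0)).congr_deriv ?_
    rw [hl0, entropicSqVelocity]
    ring
  have hV : HasDerivAt (fun s : ℝ => √(z.1 2 - entropicCoeff κ n z.1 * (z.2 0 + s * v 0) ^ n))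
      (-(deriv κ (z.1 0) * z.1 1 * z.2 0 ^ (n - 1) * v 0) / √(entropicSqVelocity κ n z)) 0 := by
    have h1 := (((hl 0).fun_pow n).const_mul (entropicCoeff κ n z.1)).const_sub (z.1 2)
    refine (h1.sqrt (by rw [hl0]; exact hz.2.ne')).congr_deriv ?_
    have h2 : √(entropicSqVelocity κ n z) ≠ 0 := (Real.sqrt_pos.2 hz.2).ne'
    simp only [hl0]
    rw [← entropicSqVelocity, entropicCoeff]
    field_simp
  refine hasDerivAt_pi.2 fun i => ?_
  fin_cases i <;> simp [entropicSection, hl, hasDerivAt_const]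
  · exact hT.const_mul σ
  · simpa [entropicSqVelocity] using hV.const_mul σ
  · have h1 := (((hl 1).const_mul (z.1 1)).mul ((hl 0).pow (n - 1)))
    refine h1.congr_deriv ?_
    obtain ⟨m, rfl⟩ := Nat.exists_eq_add_of_le hn
    rw [show 2 + m - 1 = m + 1 by omega]
    simp
    ring

theorem entropicSection_mem_jetsOver {z : (Fin 4 → ℝ) × (Fin 4 → ℝ)}
    (hz : z ∈ entropicTarget κ n R I) : entropicSection κ n σ z ∈ jetsOver (R ×ˢ I) :=
  ⟨hz.1.1, hz.1.2.1, hz.1.2.2.1⟩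

theorem entropyGradient_entropicSection (hn : 2 ≤ n) (hRpos : R ⊆ Ioi 0)
    {z : (Fin 4 → ℝ) × (Fin 4 → ℝ)} (hz : z ∈ entropicTarget κ n R I) :
    entropyGradient n (entropicSection κ n σ z) = z.1 1 := by
  have h1 : z.2 1 ≠ 0 := (hRpos hz.1.2.1).ne'
  have h2 : z.2 0 ≠ 0 := hz.1.1.ne'
  simp [entropyGradient_eq hn, entropicSection, Jet.Sr, Jet.ρ, Jet.r]
  field_simp

theorem jetCoeff_entropicSection (hn : 2 ≤ n) (hRpos : R ⊆ Ioi 0)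
    {z : (Fin 4 → ℝ) × (Fin 4 → ℝ)} (hz : z ∈ entropicTarget κ n R I) :
    jetCoeff κ n (entropicSection κ n σ z) = entropicCoeff κ n z.1 := by
  rw [jetCoeff, entropyGradient_entropicSection hn hRpos hz]
  rfl

theorem energyInvariant_entropicSection (hn : 2 ≤ n) (hRpos : R ⊆ Ioi 0) (hσ : σ = 1 ∨ σ = -1)
    {z : (Fin 4 → ℝ) × (Fin 4 → ℝ)} (hz : z ∈ entropicTarget κ n R I) :
    energyInvariant κ n (entropicSection κ n σ z) = z.1 2 := by
  rw [energyInvariant_eq hn (entropicSection_mem_jetsOver hz).1.ne',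
    jetCoeff_entropicSection hn hRpos hz]
  have h1 : (entropicSection κ n σ z).U ^ 2 = entropicSqVelocity κ n z := by
    change (σ * √(entropicSqVelocity κ n z)) ^ 2 = _
    rw [mul_pow, Real.sq_sqrt hz.2.le, sq, mul_self_eq_one_of_sign hσ, one_mul]
  rw [h1, entropicSqVelocity]
  change z.1 2 - _ * z.2 0 ^ n + _ * z.2 0 ^ n = _
  ring

theorem isFibredChart_entropic (hn : 2 ≤ n) (hRo : IsOpen R) (hR : R.OrdConnected)
    (hRpos : R ⊆ Ioi 0) (hIo : IsOpen I) (hκ : ContDiffOn ℝ 1 (deriv κ) I)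
    (hσ : σ = 1 ∨ σ = -1) :
    IsFibredChart (entropicInvariants κ n σ) entropicFibre (entropicSection κ n σ)
      (travelRegion κ n (R ×ˢ I) σ) (entropicTarget κ n R I) where
  isOpen_source := isOpen_travelRegion hn hRo hRpos hIo hκ
  isOpen_target := isOpen_entropicTarget hRo hIo hκ
  mem_target := fun j hj => by
    obtain ⟨hj1, hU, hQ⟩ := (mem_travelRegion_iff hn).1 hj
    have hU0 : j.U ≠ 0 := right_ne_zero_of_mul hU.ne'
    refine ⟨⟨hj1.1, hj1.2.1, hj1.2.2, hQ⟩, ?_⟩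
    change 0 < energyInvariant κ n j - jetCoeff κ n j * j.r ^ n
    rw [energyInvariant_eq hn hj1.1.ne', add_sub_cancel_right]
    positivity
  mem_source := fun z hz => by
    refine (mem_travelRegion_iff hn).2 ⟨entropicSection_mem_jetsOver hz, ?_, ?_⟩
    · change 0 < σ * (σ * √(entropicSqVelocity κ n z))
      rw [← mul_assoc, mul_self_eq_one_of_sign hσ, one_mul]
      exact Real.sqrt_pos.2 hz.2
    · rw [energyInvariant_entropicSection hn hRpos hσ hz]
      exact hz.1.2.2.2
  left_inv := fun j hj => by
    obtain ⟨hj1, hU, hQ⟩ := (mem_travelRegion_iff hn).1 hj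
    have h1 : j.ρ ≠ 0 := (hRpos hj1.2.1).ne'
    have h2 : j.r ≠ 0 := hj1.1.ne'
    have h3 : entropyGradient n j * j.ρ * j.r ^ (n - 1) = j.Sr := by
      rw [entropyGradient_eq hn]
      field_simp
    -- The root gives `|U|`; the condition `0 < σ * U` selects the sign.
    have h4 : σ * √(energyInvariant κ n j - jetCoeff κ n j * j.r ^ n) = j.U := by
      rw [energyInvariant_eq hn h2, add_sub_cancel_right, Real.sqrt_sq_eq_abs]
      rcases hσ with rfl | rfl
      · rw [abs_of_pos (by linarith)]
        ring
      · rw [abs_of_neg (by linarith)]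
        ring
    have h5 : σ * travelIntegral n (energyInvariant κ n j) (jetCoeff κ n j) j.r
        - (σ * travelTime κ n j - j.t) = j.t := by
      rw [travelTime_eq hn h2]
      ring
    ext i
    fin_cases i
    exacts [h5, rfl, h4, rfl, rfl, rfl, rfl, h3]
  right_inv := fun z hz => by
    have h2 : (entropicSection κ n σ z).r ≠ 0 := (entropicSection_mem_jetsOver hz).1.ne'
    ext i
    fin_cases i
    · rfl
    · exact entropyGradient_entropicSection hn hRpos hz
    · exact energyInvariant_entropicSection hn hRpos hσ hz
    · change σ * travelTime κ n (entropicSection κ n σ z) -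
        (σ * travelIntegral n (z.1 2) (entropicCoeff κ n z.1) (z.2 0) - z.1 3) = z.1 3
      rw [travelTime_eq hn h2, energyInvariant_entropicSection hn hRpos hσ hz,
        jetCoeff_entropicSection hn hRpos hz]
      change σ * travelIntegral n (z.1 2) (entropicCoeff κ n z.1) (z.2 0) - _ = _
      ring
  contDiffOn_quantities := fun j hj => by
    obtain ⟨hj1, hU, hQ⟩ := (mem_travelRegion_iff hn).1 hj
    have hN := (isOpen_jetsOver (hRo.prod hIo)).mem_nhds hj1
    have hU0 : j.U ≠ 0 := right_ne_zero_of_mul hU.ne'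
    have hE : ContDiffAt ℝ 1 (entropyGradient n) j :=
      contDiffAt_pi.1 ((contDiffOn_basicInvariants hn (W := R ×ˢ I)
        fun z hz => hRpos hz.1).contDiffAt hN) 1
    have hQC : ContDiffAt ℝ 1 (energyInvariant κ n) j :=
      (contDiffOn_energyInvariant hRpos hκ).contDiffAt hN
    have hS : ContDiffAt ℝ 1 (fun j : Jet => j.S) j := contDiffAt_pi.1 contDiffAt_id 4
    have hc : ContDiffAt ℝ 1 (jetCoeff κ n) j :=
      (contDiffAt_const.mul ((hκ.contDiffAt (hIo.mem_nhds hj1.2.2)).comp j hS)).mul hE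
    have hT : ContDiffAt ℝ 1 (travelTime κ n) j := by
      have h1 : ContDiffAt ℝ 1
          (fun j => travelIntegral n (energyInvariant κ n j) (jetCoeff κ n j) j.r) j := by
        refine contDiffAt_travelIntegral hQC hc (contDiffAt_pi.1 contDiffAt_id 1) hQ ?_
        rw [energyInvariant_eq hn hj1.1.ne', add_sub_cancel_right]
        positivity
      refine h1.congr_of_eventuallyEq ?_
      filter_upwards [hN] with j' hj' using travelTime_eq hn hj'.1.ne'
    refine ContDiffAt.contDiffWithinAt (contDiffAt_pi.2 fun i => ?_)
    fin_cases i
    exacts [hS, hE, hQC, (contDiffAt_const.mul hT).sub (contDiffAt_pi.1 contDiffAt_id 0)]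
  continuousOn_fibre := by
    refine (continuous_pi fun i => ?_).continuousOn
    fin_cases i <;> exact continuous_apply _
  contDiffOn_symm := contDiffOn_entropicSection hIo hκ
  convex_fibre := fun x y hy y' hy' a b ha hb hab => by
    refine ⟨⟨convex_Ioi (0 : ℝ) hy.1.1 hy'.1.1 ha hb hab,
      hR.convex hy.1.2.1 hy'.1.2.1 ha hb hab, hy.1.2.2⟩, ?_⟩
    have h0 : 0 ≤ (a • y + b • y') 0 := (convex_Ioi (0 : ℝ) hy.1.1 hy'.1.1 ha hb hab).le
    change 0 < x 2 - entropicCoeff κ n x * (a • y + b • y') 0 ^ n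
    -- The intermediate radius is at most the larger endpoint radius, where the squared velocity is
    -- positive.
    rcases le_total (y 0) (y' 0) with h | h
    · exact sub_mul_pow_pos hy.1.2.2.2 hy'.2 h0
        (convex_Iic (y' 0) h self_mem_Iic ha hb hab)
    · exact sub_mul_pow_pos hy.1.2.2.2 hy.2 h0
        (convex_Iic (y 0) self_mem_Iic h ha hb hab)

/-! ### Invariants of an entropic equation of state -/

theorem exists_fderiv_entropicSection_eq (hn : 2 ≤ n) (hRo : IsOpen R) (hIo : IsOpen I)
    (hκ : ContDiffOn ℝ 1 (deriv κ) I) {z : (Fin 4 → ℝ) × (Fin 4 → ℝ)}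
    (hz : z ∈ entropicTarget κ n R I) {w : Jet}
    (h0 : w 0 = σ * (w 1 / √(entropicSqVelocity κ n z)))
    (h2 : w 2 = σ * (-(deriv κ (z.1 0) * z.1 1 * z.2 0 ^ (n - 1) * w 1) /
      √(entropicSqVelocity κ n z))) (h4 : w 4 = 0)
    (h7 : w 7 = z.1 1 * (w 3 * z.2 0 ^ (n - 1) +
      z.2 1 * (((n : ℝ) - 1) * z.2 0 ^ (n - 2) * w 1))) :
    ∃ v, w = fderiv ℝ (entropicSection κ n σ) z (0, v) := by
  refine ⟨![w 1, w 3, w 5, w 6], ?_⟩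
  rw [fderiv_entropicSection hn hRo hIo hκ hz]
  ext i
  fin_cases i
  exacts [h0, rfl, h2, rfl, h4, rfl, rfl, h7]

/-- This is the invariance of all four quantities: with `r` as curve parameter, the `t` and `U`
components reduce to `dt/dr = 1/U` and `dU/dr = -κ'(S) S_r / (ρ U)`, using `σ² = 1`. -/
theorem eulerDirection_entropicSection (hn : 2 ≤ n) (hRo : IsOpen R) (hRpos : R ⊆ Ioi 0)
    (hIo : IsOpen I) (hκ : ContDiffOn ℝ 1 (deriv κ) I) (hpκ : ∀ ρ ∈ R, ∀ S ∈ I, p ρ S = κ S)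
    (hσ : σ = 1 ∨ σ = -1) {z : (Fin 4 → ℝ) × (Fin 4 → ℝ)} (hz : z ∈ entropicTarget κ n R I)
    (a b c : ℝ) :
    ∃ v, eulerDirection p n (entropicSection κ n σ z) a b c =
      fderiv ℝ (entropicSection κ n σ) z (0, v) := by
  have h1 : z.2 1 ≠ 0 := (hRpos hz.1.2.1).ne'
  have h2 : z.2 0 ≠ 0 := hz.1.1.ne'
  have hk : √(entropicSqVelocity κ n z) ≠ 0 := (Real.sqrt_pos.2 hz.2).ne'
  have hσσ := mul_self_eq_one_of_sign hσ
  have hj := entropicSection_mem_jetsOver (σ := σ) hz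
  have hdS := dS_eq_deriv_entropy hIo hpκ hj.2.1 hj.2.2
  have hdR := dRho_eq_zero hRo hpκ hj.2.1 hj.2.2
  refine exists_fderiv_entropicSection_eq hn hRo hIo hκ hz ?_ ?_ rfl ?_
  · change 1 = σ * (σ * √(entropicSqVelocity κ n z) / √(entropicSqVelocity κ n z))
    rw [mul_div_assoc, div_self hk, mul_one, hσσ]
  · simp only [eulerDirection, hdS, hdR]
    simp [entropicSection, Jet.S, Jet.Sr, Jet.ρ, Jet.U]
    field_simp
    linear_combination deriv κ (z.1 0) * z.1 1 * hσσ
  · obtain ⟨m, rfl⟩ := Nat.exists_eq_add_of_le hn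
    simp [eulerDirection, entropicSection, Jet.Sr, Jet.ρ, Jet.r, Jet.Ur, Jet.U]
    rw [show 1 + m = m + 1 by omega]
    field_simp
    ring

theorem exists_dS_ne_zero (hIo : IsOpen I)
    (hκ : ContDiffOn ℝ 2 κ I) (hpκ : ∀ ρ ∈ R, ∀ S ∈ I, p ρ S = κ S)
    (hne : ∀ V ⊆ I, IsOpen V → V.Nonempty → ∃ s ∈ V, ∃ s' ∈ V, κ s ≠ κ s') :
    ∀ V ⊆ R ×ˢ I, IsOpen V → V.Nonempty → ∃ z ∈ V, dS p z.1 z.2 ≠ 0 := by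
  rintro V hV hVo ⟨z, hz⟩
  by_contra! hcon
  obtain ⟨ε, hε, hball⟩ := Metric.isOpen_iff.1 hVo z hz
  rw [← ball_prod_same] at hball
  -- At fixed density `V` contains an interval of entropies; if `p_S = κ'` vanished there, `κ` would
  -- be constant on it.
  have hb : ∀ s ∈ Metric.ball z.2 ε, (z.1, s) ∈ V := fun s hs =>
    hball ⟨Metric.mem_ball_self hε, hs⟩
  have hd : ∀ s ∈ Metric.ball z.2 ε, HasDerivWithinAt κ 0 (Metric.ball z.2 ε) s := fun s hs => by
    have h1 := hV (hb s hs)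
    have h2 := ((hκ.contDiffAt (hIo.mem_nhds h1.2)).differentiableAt two_ne_zero).hasDerivAt
    rw [← dS_eq_deriv_entropy hIo hpκ h1.1 h1.2, hcon _ (hb s hs)] at h2
    exact h2.hasDerivWithinAt
  obtain ⟨s, hs, s', hs', hss⟩ := hne (Metric.ball z.2 ε) (fun s hs => (hV (hb s hs)).2)
    Metric.isOpen_ball ⟨z.2, Metric.mem_ball_self hε⟩
  have := (convex_ball z.2 ε).norm_image_sub_le_of_norm_hasDerivWithin_le (C := 0) hd (by simp)
    hs' hs
  exact hss (by simpa [sub_eq_zero] using this)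

/-- The scalar invariants of an entropic equation of state. -/
theorem isInvariantOn_iff_entropic (hn : 2 ≤ n) (hRo : IsOpen R) (hR : R.OrdConnected)
    (hR0 : R.Nonempty) (hRpos : R ⊆ Ioi 0) (hIo : IsOpen I)
    (hp : ContDiffOn ℝ 2 (Function.uncurry p) (R ×ˢ I)) (hpκ : ∀ ρ ∈ R, ∀ S ∈ I, p ρ S = κ S)
    (hne : ∀ V ⊆ I, IsOpen V → V.Nonempty → ∃ s ∈ V, ∃ s' ∈ V, κ s ≠ κ s')
    (hσ : σ = 1 ∨ σ = -1) :
    (∀ J, IsInvariantOn p n (travelRegion κ n (R ×ˢ I) σ) J ↔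
      IsFunctionOf (entropicInvariants κ n σ) J (travelRegion κ n (R ×ˢ I) σ)) ∧
    (∀ D ⊆ travelRegion κ n (R ×ˢ I) σ, IsOpen D → ∀ J,
      IsInvariantOn p n D J ↔ IsLocallyFunctionOf (entropicInvariants κ n σ) J D) := by
  have hκ2 := contDiffOn_entropy hR0 hp hpκ
  have hκ := contDiffOn_deriv_entropy hIo hκ2
  have hW := hRo.prod hIo
  have hc := isFibredChart_entropic hn hRo hR hRpos hIo hκ hσ
  have hpos : ∀ z ∈ R ×ˢ I, 0 < z.1 := fun z hz => hRpos hz.1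
  refine hc.isInvariantOn_iff fun D hDD hD J hJ => ?_
  have hDW : D ⊆ jetsOver (R ×ˢ I) := fun j hj => (hDD hj).1
  refine ⟨fun h z hz hzD v => ?_, fun h =>
    (isInvariantOn_iff_eulerDirection hW hp hpos hDW).2 ⟨hJ, fun j hj a b c => ?_⟩⟩
  · obtain ⟨h5, h6, h37, -, htr⟩ := h.determining_equations hW hp hpos hDW hD (Or.inr rfl)
      (exists_dS_ne_zero hIo hκ2 hpκ hne) _ hzD
    have hj := entropicSection_mem_jetsOver (σ := σ) hz
    rw [dS_eq_deriv_entropy hIo hpκ hj.2.1 hj.2.2] at htr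
    rw [fderiv_entropicSection hn hRo hIo hκ hz, fderiv_jet_apply, Fin.sum_univ_eight]
    simp only [h5, h6]
    have hρ : z.2 1 ≠ 0 := (hRpos hz.1.2.1).ne'
    have hr : z.2 0 ≠ 0 := hz.1.1.ne'
    have hk : √(entropicSqVelocity κ n z) ≠ 0 := (Real.sqrt_pos.2 hz.2).ne'
    obtain ⟨m, rfl⟩ := Nat.exists_eq_add_of_le hn
    generalize jetPartial J 0 (entropicSection κ (2 + m) σ z) = P0 at *
    generalize jetPartial J 1 (entropicSection κ (2 + m) σ z) = P1 at *
    generalize jetPartial J 2 (entropicSection κ (2 + m) σ z) = P2 at *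
    generalize jetPartial J 3 (entropicSection κ (2 + m) σ z) = P3 at *
    generalize jetPartial J 7 (entropicSection κ (2 + m) σ z) = P7 at *
    simp [entropicSection, Jet.r, Jet.ρ, Jet.Sr, Jet.S, Jet.U] at h37 htr ⊢
    generalize √(entropicSqVelocity κ (2 + m) z) = k at *
    have h3 : P3 = -(z.1 1 * z.2 0 ^ (1 + m) * P7) := by
      refine mul_left_cancel₀ hρ ?_
      linear_combination h37
    -- With `P3` and `P0` solved for, `P0` from the transport equation with `U = σ k`, the
    -- derivative along an arbitrary fibre direction becomes an expression in `P1`, `P2`, `P7` that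
    -- vanishes identically.
    subst h3
    have h0 : P0 = -(σ * k * P1) + deriv κ (z.1 0) * z.1 1 * z.2 0 ^ (1 + m) * P2
        + (2 + (m : ℝ) - 1) / z.2 0 * (σ * k) * z.2 1 * -(z.1 1 * z.2 0 ^ (1 + m) * P7) := by
      field_simp at htr ⊢
      linear_combination htr
    rw [h0]
    rcases hσ with rfl | rfl
    · field_simp
      ring
    · field_simp
      ring
  · have hz := hc.mem_target j (hDD hj)
    have hjz := hc.left_inv j (hDD hj)
    obtain ⟨v, hv⟩ := eulerDirection_entropicSection hn hRo hRpos hIo hκ hpκ hσ hz a b c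
    have := h _ hz (by rwa [hjz]) v
    rwa [← hv, hjz] at this

end EntropicChart

end RadialEuler

end

/-! ### The classification theorem -/

theorem theorem1 (n : ℕ) (hn : 2 ≤ n) (R I : Set ℝ)
    (hR_open : IsOpen R) (hR_conn : R.OrdConnected) (hR_ne : R.Nonempty) (hR_pos : R ⊆ Ioi 0)
    (hI_open : IsOpen I) (hI_conn : I.OrdConnected) (hI_ne : I.Nonempty)
    (p : ℝ → ℝ → ℝ) (hp : ContDiffOn ℝ 2 (Function.uncurry p) (R ×ˢ I))
    (hp_nonconst : ∃ x ∈ R ×ˢ I, ∃ y ∈ R ×ˢ I, p x.1 x.2 ≠ p y.1 y.2) :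
    -- (i) general equation of state
    ((∀ W ⊆ R ×ˢ I, IsOpen W → W.Nonempty → ∃ x ∈ W, RadialEuler.dRho p x.1 x.2 ≠ 0) →
      (∀ J : RadialEuler.Jet → ℝ,
        RadialEuler.IsInvariantOn p n (RadialEuler.jetsOver (R ×ˢ I)) J ↔
          RadialEuler.IsFunctionOf (RadialEuler.basicInvariants n) J
            (RadialEuler.jetsOver (R ×ˢ I))) ∧
      (∀ D ⊆ RadialEuler.jetsOver (R ×ˢ I), IsOpen D → ∀ J : RadialEuler.Jet → ℝ,
        RadialEuler.IsInvariantOn p n D J ↔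
          RadialEuler.IsLocallyFunctionOf (RadialEuler.basicInvariants n) J D)) ∧
    -- (ii) only entropic equations of state admit additional invariants
    ((∀ W ⊆ R ×ˢ I, IsOpen W → W.Nonempty → RadialEuler.HasAdditionalInvariant p n W) ↔
      RadialEuler.IsEntropic p R I) ∧
    (AnalyticOnNhd ℝ (Function.uncurry p) (R ×ˢ I) →
      (RadialEuler.HasAdditionalInvariant p n (R ×ˢ I) ↔ RadialEuler.IsEntropic p R I)) ∧
    -- (ii) the invariants of an entropic equation of state
    (∀ κ : ℝ → ℝ, (∀ ρ ∈ R, ∀ S ∈ I, p ρ S = κ S) →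
      (∀ V ⊆ I, IsOpen V → V.Nonempty → ∃ s ∈ V, ∃ s' ∈ V, κ s ≠ κ s') →
      RadialEuler.IsInvariantOn p n (RadialEuler.jetsOver (R ×ˢ I))
        (RadialEuler.energyInvariant κ n) ∧
      ∀ σ : ℝ, σ = 1 ∨ σ = -1 →
        (∀ J : RadialEuler.Jet → ℝ,
          RadialEuler.IsInvariantOn p n (RadialEuler.travelRegion κ n (R ×ˢ I) σ) J ↔
            RadialEuler.IsFunctionOf (RadialEuler.entropicInvariants κ n σ) J
              (RadialEuler.travelRegion κ n (R ×ˢ I) σ)) ∧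
        (∀ D ⊆ RadialEuler.travelRegion κ n (R ×ˢ I) σ, IsOpen D →
          ∀ J : RadialEuler.Jet → ℝ,
            RadialEuler.IsInvariantOn p n D J ↔
              RadialEuler.IsLocallyFunctionOf (RadialEuler.entropicInvariants κ n σ) J D)) := by
  refine ⟨fun hq => RadialEuler.isInvariantOn_iff_basic hn hR_open hR_conn hR_pos hI_open hp hq,
    RadialEuler.forall_hasAdditionalInvariant_iff hn hR_open hR_conn hR_ne hR_pos hI_open hp
      hp_nonconst,
    RadialEuler.hasAdditionalInvariant_iff_of_analytic hn hR_open hR_conn hR_ne hR_pos hI_open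
      hI_conn hI_ne hp hp_nonconst, fun κ hκ hne =>
    ⟨RadialEuler.isInvariantOn_energyInvariant hn hR_open hR_ne hR_pos hI_open hp hκ,
      fun σ hσ => RadialEuler.isInvariantOn_iff_entropic hn hR_open hR_conn hR_ne hR_pos hI_open hp
        hκ hne hσ⟩⟩
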